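/- All matroids are finite. For a field $\mathbb F$, a matroid $M$ is $\mathbb F$-representable if there are a non-negative integer $n$ and vectors $v_e\in\mathbb F^n$ $(e\in E(M))$ such that a set $I\subseteq E(M)$ is independent in $M$ if and only if the family $(v_e)_{e\in I}$ is linearly independent over $\mathbb F$. A matroid $M$ is an excluded minor for $\mathbb R$-representability if $M$ is not $\mathbb R$-representable but every proper minor of $M$ is $\mathbb R$-representable. Theorem. For every $\mathbb R$-representable matroid $N$ there is a matroid $M$ such that $M$ is $\mathbb C$-representable, $M$ is an excluded minor for $\mathbb R$-representability, and $N$ is a minor of $M$. -/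

import Mathlib

namespace Matroid

/-- `M` is representable over the field `F`: its elements can be labelled by the columns of a
matrix with finitely many rows over `F` (`v e` is the column of `e`, repeated and zero columns
being allowed), so that a set of elements is independent in `M` exactly when the corresponding
family of columns is linearly independent. The values of `v` outside the ground set play no role. -/
def IsRepresentable {α : Type*} (F : Type*) [Field F] (M : Matroid α) : Prop :=
  ∃ (n : ℕ) (v : α → (Fin n → F)), ∀ I ⊆ M.E, (M.Indep I ↔ LinearIndepOn F v I)

/-- `M` is an excluded minor for representability over `F`: it is a finite matroid which is not
representable over `F`, and each of its proper minors is representable over `F`. -/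
def IsExcludedMinorFor {α : Type*} (F : Type*) [Field F] (M : Matroid α) : Prop :=
  M.Finite ∧ ¬ M.IsRepresentable F ∧ ∀ N : Matroid α, N <m M → N.IsRepresentable F

end Matroid

open Set Module

/-! The complex configuration consists of two blocks and a plane. Each block is a basis of a real
space together with minus its sum. A generic lift by a three-dimensional space makes the span of
block `i` meet the plane in one prescribed point `q i` (`exists_generic_lift`). In the plane lie
three points on each of two lines, and the two centres `q i` project the first triple onto the
second by bijections that differ by a cyclic shift. Any field representing this has a root of `X ^ 2
+ X + 1` (`exists_root_of_planeLiftIndep`), so ℂ works and ℝ does not.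

The obstruction needs both centres. Deleting an element of block `i` removes the constraint of `q
i`. Contracting it removes the constraint of the other centre: a set containing that element and the
whole other block has nullity at least two before lifting, which leaves room for only one plane
element. A single perspectivity is realizable over ℝ, so these deletions and contractions are real
(`isRepresentable_deleteElem_and_contractElem`). Hence every excluded minor inside the configuration
keeps both blocks and loses only plane elements.

The given matroid is recovered from the blocks alone. By `exists_bases_blockIndep_iff` the bases can
be chosen so that contracting part of one block turns part of the other into the given vectors plus
three zero vectors. Whatever rank of the plane has not yet been contracted is absorbed by
contracting suitably many of these three spare elements (`planeLiftIndep_union_iff`). -/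

/-! ### Independence along lines of vector families -/

/-- Linear independence of a subfamily of a finite family, through coefficients supported on it. -/
theorem linearIndepOn_iff_fintype {K τ V : Type*} [Field K] [Fintype τ] [AddCommGroup V]
    [Module K V] {v : τ → V} {I : Set τ} :
    LinearIndepOn K v I ↔
      ∀ c : τ → K, (∀ x ∉ I, c x = 0) → ∑ x, c x • v x = 0 → ∀ x, c x = 0 := by
  classical
  constructor
  · intro h c hc hs x
    by_cases hx : x ∈ I
    · rw [linearIndepOn_iff''] at h
      exact h (Finset.univ.filter (· ∈ I)) c (by simp) (by simpa using hc)
        (by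
          rw [← hs, Finset.sum_filter]
          refine Finset.sum_congr rfl fun y _ ↦ ?_
          split_ifs with hy
          · rfl
          · simp [hc y hy]) x (by simpa using hx)
    · exact hc x hx
  · intro h
    rw [linearIndepOn_iff'']
    intro s c hs hc hsum x _
    refine h c (fun x hx ↦ hc x fun hxs ↦ hx (hs hxs)) ?_ x
    rw [← hsum]
    exact (Finset.sum_subset (Finset.subset_univ s) fun x _ hx ↦ by simp [hc x hx]).symm

/-- On a line of families through an independent one, all but finitely many are independent. -/
theorem LinearIndependent.finite_line_exceptions {K J V : Type*} [Field K] [Finite J]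
    [AddCommGroup V] [Module K V] {v v' : J → V} (h : LinearIndependent K v') :
    {t : K | ¬ LinearIndependent K (fun x ↦ v x + t • (v' x - v x))}.Finite := by
  classical
  have := Fintype.ofFinite J
  -- `φ` reads coordinates along `v'`, so at `t = 1` the matrix below is the identity and its
  -- determinant is a nonzero polynomial in `t`.
  obtain ⟨φ, hφ⟩ := (Finsupp.linearCombination K v').exists_leftInverse_of_injective
    (LinearMap.ker_eq_bot.2 h)
  have hφv : ∀ x y, φ (v' x) y = if x = y then 1 else 0 := by
    intro x y
    have := LinearMap.congr_fun hφ (Finsupp.single x 1)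
    simp only [LinearMap.comp_apply, Finsupp.linearCombination_single, one_smul,
      LinearMap.id_apply] at this
    rw [this, Finsupp.single_apply]
  let A : Matrix J J (Polynomial K) := Matrix.of fun x y ↦
    Polynomial.C (φ (v x) y) + Polynomial.X * Polynomial.C (φ (v' x) y - φ (v x) y)
  have hA : ∀ t, (A.det).eval t =
      (Matrix.of fun x y ↦ φ (v x + t • (v' x - v x)) y).det := by
    intro t
    rw [← Polynomial.coe_evalRingHom, RingHom.map_det]
    congr 1
    ext x y
    simp [A]
  have h1 : A.det.eval 1 = 1 := by
    rw [hA]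
    convert Matrix.det_one (n := J) (R := K) using 2
    ext x y
    simp [hφv, Matrix.one_apply]
  have hne : A.det ≠ 0 := fun h0 ↦ by simp [h0] at h1
  refine (A.det.roots.toFinset.finite_toSet).subset fun t ht ↦ ?_
  by_contra hroot
  apply ht
  have hdet : (Matrix.of fun x y ↦ φ (v x + t • (v' x - v x)) y).det ≠ 0 := by
    rw [← hA]
    intro h0
    exact hroot (by simp [hne, h0])
  have hrow := Matrix.linearIndependent_rows_of_det_ne_zero hdet
  have : LinearIndependent K
      (((Finsupp.lcoeFun : (J →₀ K) →ₗ[K] J → K) ∘ₗ φ) ∘ fun x ↦ v x + t • (v' x - v x)) := hrow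
  exact this.of_comp

/-- In a set of families closed under taking lines, finitely many independence requirements that
can be met one at a time can be met together. -/
theorem exists_forall_linearIndepOn {K τ V A : Type*} [Field K] [Infinite K] [Finite τ]
    [AddCommGroup V] [Module K V] [AddCommGroup A] [Module K A] (S : Set A)
    (hS : ∀ p ∈ S, ∀ p' ∈ S, ∀ t : K, p + t • (p' - p) ∈ S) (v : A → τ → V)
    (hv : ∀ p p' : A, ∀ t : K, ∀ x, v (p + t • (p' - p)) x = v p x + t • (v p' x - v p x))
    (hne : S.Nonempty) (𝒥 : Finset (Set τ))
    (h𝒥 : ∀ I ∈ 𝒥, ∃ p ∈ S, LinearIndepOn K (v p) I) :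
    ∃ p ∈ S, ∀ I ∈ 𝒥, LinearIndepOn K (v p) I := by
  classical
  induction 𝒥 using Finset.induction_on with
  | empty => exact ⟨hne.some, hne.some_mem, by simp⟩
  | insert J 𝒥 _ ih =>
    obtain ⟨p, hp, hpI⟩ := ih fun I hI ↦ h𝒥 I (Finset.mem_insert_of_mem hI)
    obtain ⟨p', hp', hpJ⟩ := h𝒥 J (Finset.mem_insert_self _ _)
    have hfinJ : {t : K | ¬ LinearIndepOn K (v (p + t • (p' - p))) J}.Finite := by
      convert LinearIndependent.finite_line_exceptions (v := fun x : J ↦ v p x) hpJ using 4 with t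
      unfold LinearIndepOn
      simp only [hv]
    have hfinI : ∀ I ∈ 𝒥, {t : K | ¬ LinearIndepOn K (v (p' + t • (p - p'))) I}.Finite := by
      intro I hI
      convert LinearIndependent.finite_line_exceptions (v := fun x : I ↦ v p' x) (hpI I hI)
        using 4 with t
      unfold LinearIndepOn
      simp only [hv]
    -- The same line run backwards: each requirement is tested with its own independent family at
    -- parameter 1.
    have hswap : ∀ t : K, p' + (1 - t) • (p - p') = p + t • (p' - p) := by
      intro t
      module
    have hfin : ({t : K | ¬ LinearIndepOn K (v (p + t • (p' - p))) J} ∪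
        ⋃ I ∈ 𝒥, (fun t ↦ 1 - t) ⁻¹' {t : K | ¬ LinearIndepOn K (v (p' + t • (p - p'))) I}).Finite :=
      hfinJ.union (𝒥.finite_toSet.biUnion fun I hI ↦
        (hfinI I hI).preimage (sub_right_injective.injOn))
    obtain ⟨t, ht⟩ := hfin.infinite_compl.nonempty
    simp only [mem_compl_iff, mem_union, mem_iUnion, mem_preimage, mem_ofPred_eq, not_or, not_exists,
      not_not] at ht
    refine ⟨_, hS p hp p' hp' t, fun I hI ↦ ?_⟩
    rcases Finset.mem_insert.1 hI with rfl | hI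
    · exact ht.1
    · rw [← hswap]
      exact ht.2 I hI

/-! ### Generic lifts with prescribed block sums -/

section Lift

variable {K X Y C P W : Type*} [Field K] [AddCommGroup P] [Module K P] [AddCommGroup W] [Module K W]

/-- The family in `P × W` that combines a family `y` in `P` with a lift by `p` of a family `w`
in `W`. -/
def liftFamily (y : Y → P) (w : X → W) (p : X → P) : X ⊕ Y → P × W :=
  Sum.elim (fun x ↦ (p x, w x)) (fun j ↦ (y j, 0))

/-- The independence condition of a generic lift of `w` by `y` in which, for each `i`, the vectors
with index in `{i} × C` add up to `q i`. -/
structure LiftIndep (y : Y → P) (q : Bool → P) (w : Bool × C → W) (I : Set ((Bool × C) ⊕ Y)) :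
    Prop where
  indepOn : LinearIndepOn K y (Sum.inr ⁻¹' I)
  exists_basis : ∃ B ⊆ Sum.inl ⁻¹' I, LinearIndepOn K w B ∧
    (Sum.inl ⁻¹' I \ B).ncard + (Sum.inr ⁻¹' I).ncard ≤ finrank K P
  notMem_span : ∀ i, (∀ c, Sum.inl (i, c) ∈ I) → q i ∉ Submodule.span K (y '' (Sum.inr ⁻¹' I))

/-- Vectors indexed by `D` that are linearly independent modulo `S`, the others being zero. -/
theorem exists_indep_mod [Fintype X] [FiniteDimensional K P] (S : Submodule K P) (D : Set X)
    (h : D.ncard + finrank K S ≤ finrank K P) :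
    ∃ p : X → P, (∀ x ∉ D, p x = 0) ∧
      ∀ c : X → K, ∑ x, c x • p x ∈ S → ∀ x ∈ D, c x = 0 := by
  classical
  have hq : D.ncard ≤ finrank K (P ⧸ S) := by
    have := S.finrank_quotient_add_finrank
    omega
  obtain ⟨f, hf⟩ := exists_linearIndependent_of_le_finrank hq
  choose g hg using fun k ↦ S.mkQ_surjective (f k)
  have e : D ≃ Fin D.ncard := by
    rw [← Nat.card_coe_set_eq]
    exact Finite.equivFin D
  refine ⟨fun x ↦ if hx : x ∈ D then g (e ⟨x, hx⟩) else 0, fun x hx ↦ by simp [hx], ?_⟩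
  intro c hc x hx
  have hli : LinearIndependent K (f ∘ e) := hf.comp _ e.injective
  rw [Fintype.linearIndependent_iff] at hli
  refine hli (fun x ↦ c x) ?_ ⟨x, hx⟩
  have h0 := (Submodule.Quotient.mk_eq_zero S).2 hc
  rw [← Submodule.mkQ_apply, map_sum] at h0
  rw [← h0, ← Finset.sum_subset (Finset.subset_univ D.toFinset)]
  · rw [← Finset.sum_coe_sort D.toFinset]
    refine Fintype.sum_equiv (Equiv.subtypeEquivRight (by simp)) _ _ fun x ↦ ?_
    simp [hg, -Submodule.mkQ_apply]
  · intro x _ hx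
    simp [show x ∉ D by simpa using hx]

/-- Coefficients vanish in three stages: off `B` by the `P`-part modulo the span of `y`, on `B` by
the `W`-part, and finally on `Y`. -/
theorem linearIndepOn_liftFamily [Fintype X] [Fintype Y] {y : Y → P} {w : X → W} {p : X → P}
    {I : Set (X ⊕ Y)} {B : Set X} (hy : LinearIndepOn K y (Sum.inr ⁻¹' I))
    (hB : LinearIndepOn K w B)
    (hp : ∀ c : X → K, (∀ x, Sum.inl x ∉ I → c x = 0) →
      ∑ x, c x • p x ∈ Submodule.span K (y '' (Sum.inr ⁻¹' I)) →
      ∀ x, Sum.inl x ∈ I → x ∉ B → c x = 0) :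
    LinearIndepOn K (liftFamily y w p) I := by
  classical
  rw [linearIndepOn_iff_fintype] at hy hB ⊢
  intro c hc hsum
  simp only [liftFamily, Fintype.sum_sum_type, Sum.elim_inl, Sum.elim_inr, Prod.smul_mk,
    smul_zero] at hsum
  have h1 : ∑ x, c (Sum.inl x) • p x + ∑ j, c (Sum.inr j) • y j = 0 := by
    simpa [Prod.fst_sum] using congrArg Prod.fst hsum
  have h2 : ∑ x, c (Sum.inl x) • w x = 0 := by
    simpa [Prod.snd_sum] using congrArg Prod.snd hsum
  have hspan : ∑ j, c (Sum.inr j) • y j ∈ Submodule.span K (y '' (Sum.inr ⁻¹' I)) := by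
    refine Submodule.sum_mem _ fun j _ ↦ ?_
    by_cases hj : Sum.inr j ∈ I
    · exact Submodule.smul_mem _ _ (Submodule.subset_span ⟨j, hj, rfl⟩)
    · simp [hc _ hj]
  have hD := hp (fun x ↦ c (Sum.inl x)) (fun x hx ↦ hc _ hx)
    (by rw [eq_neg_of_add_eq_zero_left h1]; exact neg_mem hspan)
  have hoff : ∀ x, x ∉ B → c (Sum.inl x) = 0 := fun x hx ↦ by
    by_cases hxI : Sum.inl x ∈ I
    · exact hD x hxI hx
    · exact hc _ hxI
  have hX := hB (fun x ↦ c (Sum.inl x)) hoff h2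
  have hY := hy (fun j ↦ c (Sum.inr j)) (fun j hj ↦ hc _ hj) (by simpa [hX] using h1)
  rintro (x | j)
  · exact hX x
  · exact hY j

theorem exists_notMem_of_sum_eq_zero [Fintype C] {w : Bool × C → W} {i : Bool}
    (hw : ∑ c, w (i, c) = 0) (c₀ : C) {B : Set (Bool × C)} (hB : LinearIndepOn K w B) : ∃ c, (i, c) ∉ B := by
  classical
  by_contra! hcon
  rw [linearIndepOn_iff_fintype] at hB
  have := hB (fun x ↦ if x.1 = i then 1 else 0)
    (by rintro ⟨k, c⟩ hx; exact if_neg fun hk : k = i ↦ hx (hk ▸ hcon c))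
    (by
      rw [Fintype.sum_prod_type, Fintype.sum_bool]
      cases i <;> simp [hw]) (i, c₀)
  simp at this

variable [Fintype C] [Fintype Y] [FiniteDimensional K P] [FiniteDimensional K W]
  {y : Y → P} {q : Bool → P} {w : Bool × C → W} {I : Set ((Bool × C) ⊕ Y)}

/-- The elements of `I` outside `B` receive `P`-parts independent modulo the plane elements of `I`,
and one entry per block is then altered to correct the sum. An altered entry outside `I` is
harmless; a block inside `I` must use an element outside `B`. The bound `hcard` prevents both blocks
from lying in `I`. -/
theorem LiftIndep.exists_lift (hw : ∀ i, ∑ c, w (i, c) = 0)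
    (hcard : finrank K W + finrank K P < 2 * Fintype.card C)
    (h : LiftIndep (K := K) y q w I) :
    ∃ p : Bool × C → P, (∀ i, ∑ c, p (i, c) = q i) ∧ LinearIndepOn K (liftFamily y w p) I := by
  classical
  obtain ⟨hy, ⟨B, hBI, hB, hle⟩, hq⟩ := h
  have hBcard : B.ncard ≤ finrank K W := by
    have := hB.linearIndependent.fintype_card_le_finrank
    rwa [← Nat.card_eq_fintype_card, Nat.card_coe_set_eq] at this
  have hfin : finrank K (Submodule.span K (y '' (Sum.inr ⁻¹' I))) ≤ (Sum.inr ⁻¹' I).ncard := by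
    refine (finrank_span_le_card _).trans ?_
    rw [← Set.ncard_eq_toFinset_card']
    exact ncard_image_le
  have hDcard : (Sum.inl ⁻¹' I \ B).ncard + B.ncard = (Sum.inl ⁻¹' I).ncard :=
    ncard_sdiff_add_ncard_of_subset hBI
  have hsum : ∀ (p : Bool × C → P) (e : Bool → C) (i : Bool),
      ∑ c, (p (i, c) + if c = e i then q i - ∑ c', p (i, c') else 0) = q i := by
    intro p e i
    simp [Finset.sum_add_distrib]
  by_cases hall : ∃ i, ∀ c, Sum.inl (i, c) ∈ I
  · obtain ⟨i, hi⟩ := hall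
    have hnot : ∃ c, Sum.inl (!i, c) ∉ I := by
      by_contra! hcon
      have huniv : (Sum.inl ⁻¹' I : Set (Bool × C)) = univ := by
        ext ⟨k, c⟩
        by_cases hk : k = i
        · subst hk; simpa using hi c
        · have : k = !i := by cases k <;> cases i <;> simp_all
          subst this; simpa using hcon c
      rw [huniv, ncard_univ, Nat.card_eq_fintype_card, Fintype.card_prod, Fintype.card_bool]
        at hDcard
      rw [huniv] at hle
      omega
    obtain ⟨c₀, hc₀⟩ := hnot
    obtain ⟨c₁, hc₁⟩ := exists_notMem_of_sum_eq_zero (hw i) c₀ hB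
    have hmemD : (i, c₁) ∈ Sum.inl ⁻¹' I \ B := ⟨hi c₁, hc₁⟩
    set S := Submodule.span K (y '' (Sum.inr ⁻¹' I)) with hS
    have hS' : finrank K (S ⊔ Submodule.span K {q i} : Submodule K P) ≤ finrank K S + 1 := by
      refine (Submodule.finrank_add_le_finrank_add_finrank _ _).trans ?_
      gcongr
      exact (finrank_span_le_card _).trans (by simp)
    have hD' := ncard_sdiff_singleton_add_one hmemD
    -- Reserving `(i, c₁)` for the correction frees the one dimension needed for independence modulo
    -- `q i` as well.
    obtain ⟨p, hp0, hp⟩ := exists_indep_mod (S ⊔ Submodule.span K {q i})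
      ((Sum.inl ⁻¹' I \ B) \ {(i, c₁)}) (by omega)
    let e : Bool → C := fun k ↦ if k = i then c₁ else c₀
    have hei : e i = c₁ := if_pos rfl
    have heni : e (!i) = c₀ := if_neg (by simp)
    refine ⟨fun x ↦ p x + if x.2 = e x.1 then q x.1 - ∑ c', p (x.1, c') else 0,
      fun k ↦ hsum p e k, ?_⟩
    refine linearIndepOn_liftFamily hy hB fun c hc hmem ↦ ?_
    -- The correction at `c₁` lowers every coefficient of block `i` by `c (i, c₁)` and contributes
    -- `c (i, c₁) • q i`; the corrected entry of the other block lies outside `I`.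
    have hexp : ∑ x, c x • (p x + if x.2 = e x.1 then q x.1 - ∑ c', p (x.1, c') else 0) =
        ∑ x, (c x - if x.1 = i then c (i, c₁) else 0) • p x + c (i, c₁) • q i := by
      have h1 : ∀ k, ∑ a, c (k, a) • (p (k, a) + if a = e k then q k - ∑ c', p (k, c') else 0) =
          ∑ a, (c (k, a) - c (k, e k)) • p (k, a) + c (k, e k) • q k := by
        intro k
        simp only [smul_add, smul_ite, smul_zero, Finset.sum_add_distrib, Finset.sum_ite_eq',
          Finset.mem_univ, if_true, sub_smul, Finset.sum_sub_distrib, ← Finset.smul_sum, smul_sub]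
        abel
      have h2 : c (!i, e (!i)) = 0 := hc _ (by rwa [heni])
      simp only [Fintype.sum_prod_type, Fintype.sum_bool, h1]
      cases i
      · simp only [Bool.not_false] at h2
        simp [h2, hei, add_assoc]
      · simp only [Bool.not_true] at h2
        simp [h2, hei, add_right_comm]
    rw [hexp] at hmem
    have hmem' : ∑ x, (c x - if x.1 = i then c (i, c₁) else 0) • p x ∈
        S ⊔ Submodule.span K {q i} := by
      rw [← add_sub_cancel_right (∑ x, (c x - if x.1 = i then c (i, c₁) else 0) • p x)
        (c (i, c₁) • q i)]
      exact sub_mem (Submodule.mem_sup_left hmem) (Submodule.mem_sup_right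
        (Submodule.smul_mem _ _ (Submodule.mem_span_singleton_self _)))
    have hzero := hp _ hmem'
    have hsum0 : ∑ x, (c x - if x.1 = i then c (i, c₁) else 0) • p x = 0 := by
      refine Finset.sum_eq_zero fun x _ ↦ ?_
      by_cases hx : x ∈ (Sum.inl ⁻¹' I \ B) \ {(i, c₁)}
      · rw [hzero x hx, zero_smul]
      · rw [hp0 x hx, smul_zero]
    rw [hsum0, zero_add] at hmem
    have hc1 : c (i, c₁) = 0 := by
      by_contra hne
      exact hq i hi ((Submodule.smul_mem_iff _ hne).1 hmem)
    intro x hxI hxB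
    by_cases hx : x = (i, c₁)
    · rw [hx, hc1]
    · simpa [hc1] using hzero x ⟨⟨hxI, hxB⟩, hx⟩
  · push Not at hall
    choose e he using hall
    obtain ⟨p, -, hp⟩ := exists_indep_mod (Submodule.span K (y '' (Sum.inr ⁻¹' I)))
      (Sum.inl ⁻¹' I \ B) (by omega)
    refine ⟨fun x ↦ p x + if x.2 = e x.1 then q x.1 - ∑ c', p (x.1, c') else 0,
      fun i ↦ hsum p e i, ?_⟩
    have heq : ∀ x, Sum.inl x ∈ I →
        p x + (if x.2 = e x.1 then q x.1 - ∑ c', p (x.1, c') else 0) = p x := by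
      rintro ⟨i, c⟩ hx
      rw [if_neg, add_zero]
      intro hce
      exact he i (hce ▸ hx)
    refine linearIndepOn_liftFamily hy hB fun c hc hmem x hxI hxB ↦ hp c ?_ x ⟨hxI, hxB⟩
    convert hmem using 2 with x
    by_cases hx : Sum.inl x ∈ I
    · rw [heq x hx]
    · simp [hc x hx]

/-- Projection to `W` has kernel `P`, which bounds the excess over a maximal independent `B`. A full
block sums to `(q i, 0)`, a dependency as soon as `q i` lies in the span of the plane elements
present. -/
theorem LiftIndep.of_linearIndepOn [Nonempty C] (hw : ∀ i, ∑ c, w (i, c) = 0) {p : Bool × C → P}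
    (hp : ∀ i, ∑ c, p (i, c) = q i) (h : LinearIndepOn K (liftFamily y w p) I) :
    LiftIndep (K := K) y q w I := by
  classical
  have hy : LinearIndepOn K y (Sum.inr ⁻¹' I) := by
    have h1 : LinearIndepOn K (liftFamily y w p ∘ Sum.inr) (Sum.inr ⁻¹' I) :=
      (h.mono (image_preimage_subset _ _)).comp_of_image Sum.inr_injective.injOn
    exact LinearIndepOn.of_comp (LinearMap.inl K P W) h1
  refine ⟨hy, ?_, fun i hi hmem ↦ ?_⟩
  · obtain ⟨B, hBI, -, hspan, hB⟩ :=
      exists_linearIndepOn_extension (linearIndepOn_empty K w) (empty_subset (Sum.inl ⁻¹' I))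
    refine ⟨B, hBI, hB, ?_⟩
    have hle : Submodule.span K (liftFamily y w p '' I) ≤
        LinearMap.range (LinearMap.inl K P W) ⊔
          (Submodule.span K (w '' B)).map (LinearMap.inr K P W) := by
      rw [Submodule.span_le]
      rintro _ ⟨x | j, hx, rfl⟩
      · exact Submodule.mem_sup.2 ⟨(p x, 0), ⟨p x, rfl⟩, (0, w x),
          ⟨w x, hspan ⟨x, hx, rfl⟩, rfl⟩, by simp [liftFamily]⟩
      · exact Submodule.mem_sup_left ⟨y j, rfl⟩
    have hIcard : finrank K (Submodule.span K (liftFamily y w p '' I)) = I.ncard := by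
      rw [image_eq_range]
      have := finrank_span_eq_card h.linearIndependent
      rw [← Nat.card_eq_fintype_card, Nat.card_coe_set_eq] at this
      exact this
    have hBcard : finrank K (Submodule.span K (w '' B)) = B.ncard := by
      rw [image_eq_range]
      have := finrank_span_eq_card hB.linearIndependent
      rw [← Nat.card_eq_fintype_card, Nat.card_coe_set_eq] at this
      exact this
    have h1 := (Submodule.finrank_mono hle).trans
      (Submodule.finrank_add_le_finrank_add_finrank _ _)
    rw [LinearMap.finrank_range_of_inj LinearMap.inl_injective, hIcard] at h1
    have h1' := Submodule.finrank_map_le (LinearMap.inr K P W) (Submodule.span K (w '' B))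
    rw [hBcard] at h1'
    have h2 : (Sum.inl ⁻¹' I \ B).ncard + B.ncard = (Sum.inl ⁻¹' I).ncard :=
      ncard_sdiff_add_ncard_of_subset hBI
    have h3 : I.ncard = (Sum.inl ⁻¹' I).ncard + (Sum.inr ⁻¹' I).ncard := by
      rw [← ncard_image_of_injective (Sum.inl ⁻¹' I) (Sum.inl_injective (β := Y)),
        ← ncard_image_of_injective (Sum.inr ⁻¹' I) (Sum.inr_injective (α := Bool × C)),
        ← ncard_union_eq (by
          rw [Set.disjoint_left]
          rintro _ ⟨x, -, rfl⟩ ⟨j, -, hj⟩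
          cases hj), image_preimage_inl_union_image_preimage_inr]
    omega
  · obtain ⟨c₀⟩ := ‹Nonempty C›
    obtain ⟨f, hf, hfq⟩ : ∃ f : Y → K, (∀ j, Sum.inr j ∉ I → f j = 0) ∧ ∑ j, f j • y j = q i := by
      obtain ⟨l, hl, hlq⟩ := (Finsupp.mem_span_image_iff_linearCombination K).1 hmem
      refine ⟨l, fun j hj ↦ Finsupp.notMem_support_iff.1 fun h ↦ hj (hl h), ?_⟩
      rw [← hlq, Finsupp.linearCombination_apply, Finsupp.sum_fintype _ _ (by simp)]
    rw [linearIndepOn_iff_fintype] at h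
    have := h (Sum.elim (fun x ↦ if x.1 = i then 1 else 0) fun j ↦ - f j)
      (by
        rintro (⟨k, c⟩ | j) hx
        · exact if_neg fun hk : k = i ↦ hx (hk ▸ hi c)
        · simp [hf j hx])
      (by
        have hp' := hp i
        have hw' := hw i
        simp only [liftFamily, Fintype.sum_sum_type, Sum.elim_inl, Sum.elim_inr, Prod.smul_mk,
          smul_zero, Fintype.sum_prod_type, Fintype.sum_bool]
        ext1
        · cases i <;> simp [Prod.fst_sum, hp', hfq]
        · cases i <;> simp [Prod.snd_sum, hw']) (Sum.inl (i, c₀))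
    simp at this

/-- The generic lift: one lift realizes the independence condition for all sets at once. -/
theorem exists_generic_lift [Infinite K] [Nonempty C] (y : Y → P) (q : Bool → P)
    (hw : ∀ i, ∑ c, w (i, c) = 0) (hcard : finrank K W + finrank K P < 2 * Fintype.card C) :
    ∃ p : Bool × C → P, ∀ I, LinearIndepOn K (liftFamily y w p) I ↔
      LiftIndep (K := K) y q w I := by
  classical
  -- The prescribed sums cut out an affine subspace on which the lifted vectors depend affinely on
  -- `p`.
  let S : Set (Bool × C → P) := {p | ∀ i, ∑ c, p (i, c) = q i}
  obtain ⟨p, hp, hpI⟩ := exists_forall_linearIndepOn (K := K) S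
    (fun p hp p' hp' t i ↦ by
      simp [Finset.sum_add_distrib, ← Finset.smul_sum, hp i, hp' i])
    (liftFamily y w)
    (fun p p' t x ↦ by
      rcases x with x | j <;> ext1 <;> simp [liftFamily])
    (by
      obtain ⟨c₀⟩ := ‹Nonempty C›
      exact ⟨fun x ↦ if x.2 = c₀ then q x.1 else 0, fun i ↦ by simp⟩)
    (Finset.univ.filter fun I ↦ LiftIndep (K := K) y q w I)
    (fun I hI ↦ (Finset.mem_filter.1 hI).2.exists_lift hw hcard)
  exact ⟨p, fun I ↦ ⟨fun h ↦ .of_linearIndepOn hw hp h,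
    fun h ↦ hpI I (Finset.mem_filter.2 ⟨Finset.mem_univ _, h⟩)⟩⟩

end Lift

/-! ### Two lines and two centres in the plane -/

section Configuration

/-- The combinatorial form of the independence condition `LiftIndep` when the plane consists of
three points `(false, j)` and three points `(true, k)` on two lines. The predicate `ind` is
independence before lifting; `rel i j k` says that `(false, j)`, `(true, k)` and the `i`-th
distinguished point are collinear. -/
def PlaneLiftIndep {C : Type*} (ind : Set (Bool × C) → Prop)
    (rel : Bool → Fin 3 → Fin 3 → Prop) (I : Set ((Bool × C) ⊕ (Bool × Fin 3))) : Prop :=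
  ((Sum.inr ⁻¹' I).ncard ≤ 3 ∧ ∀ s, ∃ j, Sum.inr (s, j) ∉ I) ∧
  (∃ B ⊆ Sum.inl ⁻¹' I, ind B ∧ (Sum.inl ⁻¹' I \ B).ncard + (Sum.inr ⁻¹' I).ncard ≤ 3) ∧
  ∀ i, (∀ c, Sum.inl (i, c) ∈ I) →
    ¬ ∃ j k, Sum.inr (false, j) ∈ I ∧ Sum.inr (true, k) ∈ I ∧ rel i j k

variable {K : Type*} [Field K]

/-- Three points on each of two lines of the projective plane over `K`. -/
def twoLines (α β : Fin 3 → K) : Bool × Fin 3 → Fin 3 → K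
  | (false, j) => ![α j, 1, 0]
  | (true, j) => ![β j, 0, 1]

/-- The centre of the perspectivity `t ↦ κ t` between the lines of `twoLines`. -/
def perspectiveCentre (κ : K) : Fin 3 → K := ![0, -κ, 1]

theorem Fin.eq_zero_of_two_zero {c : Fin 3 → K} {j k : Fin 3} (hjk : j ≠ k) (hj : c j = 0)
    (hk : c k = 0) (hs : ∑ x, c x = 0) : ∀ x, c x = 0 := by
  rw [Fin.sum_univ_three] at hs
  intro x
  fin_cases j <;> fin_cases k <;> fin_cases x <;> simp_all

theorem Fin.eq_zero_of_affine_relation {c α : Fin 3 → K} (hα : Function.Injective α) {j : Fin 3}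
    (hj : c j = 0) (hs : ∑ x, c x = 0) (hα0 : ∑ x, c x * α x = 0) : ∀ x, c x = 0 := by
  have key : c (j + 1) * (α (j + 1) - α (j + 2)) = 0 := by
    rw [Fin.sum_univ_three] at hs hα0
    fin_cases j <;> simp [-mul_eq_zero] at hj ⊢ <;> simp only [hj] at hs hα0
    · linear_combination hα0 - α 2 * hs
    · linear_combination hα0 - α 0 * hs
    · linear_combination hα0 - α 1 * hs
  have hne : α (j + 1) - α (j + 2) ≠ 0 := sub_ne_zero.2 fun h ↦ by
    have := hα h
    simp at this
  exact Fin.eq_zero_of_two_zero (j := j) (k := j + 1) (by simp) hj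
    ((mul_eq_zero.1 key).resolve_right hne) hs

theorem sum_smul_twoLines (α β : Fin 3 → K) (c : Bool × Fin 3 → K) :
    ∑ x, c x • twoLines α β x = ![∑ j, c (false, j) * α j + ∑ j, c (true, j) * β j,
      ∑ j, c (false, j), ∑ j, c (true, j)] := by
  ext k
  rw [Finset.sum_apply, Fintype.sum_prod_type, Fintype.sum_bool]
  fin_cases k <;> simp [twoLines, add_comm]

/-- The lines meet in `(1, 0, 0)`, which is none of the six points, so the only dependent triples
are the two lines. -/
theorem linearIndepOn_twoLines_iff {α β : Fin 3 → K} (hα : Function.Injective α)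
    (hβ : Function.Injective β) {J : Set (Bool × Fin 3)} :
    LinearIndepOn K (twoLines α β) J ↔ J.ncard ≤ 3 ∧ ∀ s, ∃ j, (s, j) ∉ J := by
  classical
  constructor
  · intro h
    constructor
    · have := h.linearIndependent.fintype_card_le_finrank
      rw [← Nat.card_eq_fintype_card, Nat.card_coe_set_eq] at this
      simpa using this
    · intro s
      by_contra! hs
      rw [linearIndepOn_iff_fintype] at h
      have hoff : ∀ γ : Fin 3 → K, ∀ x ∉ J, (if x.1 = s then γ x.2 else 0) = 0 := by
        rintro γ ⟨t, j⟩ hx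
        exact if_neg fun ht : t = s ↦ hx (ht ▸ hs j)
      cases s
      -- Cyclic differences of `α` sum to zero and are orthogonal to `α`, which gives the dependency
      -- of three collinear points.
      · have := h _ (hoff fun j ↦ α (j + 1) - α (j + 2)) (by
          rw [sum_smul_twoLines]
          ext k
          fin_cases k <;> simp [Fin.sum_univ_three] <;> ring) (false, 0)
        simp [sub_eq_zero, hα.eq_iff] at this
      · have := h _ (hoff fun j ↦ β (j + 1) - β (j + 2)) (by
          rw [sum_smul_twoLines]
          ext k
          fin_cases k <;> simp [Fin.sum_univ_three] <;> ring) (true, 0)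
        simp [sub_eq_zero, hβ.eq_iff] at this
  · rintro ⟨hcard, hlines⟩
    obtain ⟨j₀, hj₀⟩ := hlines false
    obtain ⟨k₀, hk₀⟩ := hlines true
    -- At least three of the six points are missing, so some line misses two of its points; its
    -- equation kills the third coefficient.
    have hthird : ∃ x ∉ J, x ≠ (false, j₀) ∧ x ≠ (true, k₀) := by
      by_contra! hcon
      have hsub : Jᶜ ⊆ {(false, j₀), (true, k₀)} := by
        intro x hx
        by_cases h : x = (false, j₀)
        · exact Or.inl h
        · exact Or.inr (hcon x hx h)
      have h1 := ncard_le_ncard hsub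
      rw [ncard_pair (by simp)] at h1
      have h2 := ncard_add_ncard_compl J
      simp at h2
      omega
    obtain ⟨⟨s, j⟩, hx, hx1, hx2⟩ := hthird
    rw [linearIndepOn_iff_fintype]
    intro c hc hsum
    rw [sum_smul_twoLines] at hsum
    have e0 := congrFun hsum 0
    have e1 := congrFun hsum 1
    have e2 := congrFun hsum 2
    simp only [Fin.isValue, Matrix.cons_val, Pi.zero_apply] at e0 e1 e2
    have hboth : (∀ j, c (false, j) = 0) ∧ ∀ j, c (true, j) = 0 := by
      cases s
      · have h1 := Fin.eq_zero_of_two_zero (c := fun j ↦ c (false, j)) (j := j) (k := j₀)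
          (by simpa using hx1) (hc _ hx) (hc _ hj₀) e1
        exact ⟨h1, Fin.eq_zero_of_affine_relation (c := fun j ↦ c (true, j)) hβ (hc _ hk₀) e2
          (by simpa [h1] using e0)⟩
      · have h1 := Fin.eq_zero_of_two_zero (c := fun j ↦ c (true, j)) (j := j) (k := k₀)
          (by simpa using hx2) (hc _ hx) (hc _ hk₀) e2
        exact ⟨Fin.eq_zero_of_affine_relation (c := fun j ↦ c (false, j)) hα (hc _ hj₀) e1
          (by simpa [h1] using e0), h1⟩
    rintro ⟨_ | _, j⟩
    exacts [hboth.1 j, hboth.2 j]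

/-- The last two coordinates of the centre are nonzero, so a spanning `J` has a point on each line,
hence exactly one; the first coordinate then gives the relation. -/
theorem perspectiveCentre_mem_span_iff {α β : Fin 3 → K} {κ : K} (hκ : κ ≠ 0)
    {J : Set (Bool × Fin 3)} (hJ : J.ncard ≤ 2) :
    perspectiveCentre κ ∈ Submodule.span K (twoLines α β '' J) ↔
      ∃ j k, (false, j) ∈ J ∧ (true, k) ∈ J ∧ β k = κ * α j := by
  classical
  constructor
  · intro hmem
    obtain ⟨c, hc, hcq⟩ := (Finsupp.mem_span_image_iff_linearCombination K).1 hmem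
    rw [Finsupp.linearCombination_apply, Finsupp.sum_fintype _ _ (by simp),
      sum_smul_twoLines] at hcq
    have hoff : ∀ x ∉ J, c x = 0 := fun x hx ↦ Finsupp.notMem_support_iff.1 fun h ↦ hx (hc h)
    have e0 := congrFun hcq 0
    have e1 := congrFun hcq 1
    have e2 := congrFun hcq 2
    simp only [perspectiveCentre, Fin.isValue, Matrix.cons_val] at e0 e1 e2
    obtain ⟨j, -, hj⟩ := Finset.exists_ne_zero_of_sum_ne_zero (e1.trans_ne (neg_ne_zero.2 hκ))
    obtain ⟨k, -, hk⟩ := Finset.exists_ne_zero_of_sum_ne_zero (e2.trans_ne one_ne_zero)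
    have hjJ : (false, j) ∈ J := by_contra fun h ↦ hj (hoff _ h)
    have hkJ : (true, k) ∈ J := by_contra fun h ↦ hk (hoff _ h)
    have hJeq : {(false, j), (true, k)} = J :=
      eq_of_subset_of_ncard_le (insert_subset hjJ (singleton_subset_iff.2 hkJ))
        (by rw [ncard_pair (by simp)]; exact hJ)
    have hf : ∀ j' ≠ j, c (false, j') = 0 := fun j' h ↦ hoff _ (by simp [← hJeq, h])
    have ht : ∀ k' ≠ k, c (true, k') = 0 := fun k' h ↦ hoff _ (by simp [← hJeq, h])
    rw [Finset.sum_eq_single j (fun j' _ h ↦ hf j' h) (by simp)] at e1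
    rw [Finset.sum_eq_single k (fun k' _ h ↦ ht k' h) (by simp)] at e2
    rw [Finset.sum_eq_single j (fun j' _ h ↦ by simp [hf j' h]) (by simp),
      Finset.sum_eq_single k (fun k' _ h ↦ by simp [ht k' h]) (by simp), e1, e2] at e0
    exact ⟨j, k, hjJ, hkJ, by linear_combination e0⟩
  · rintro ⟨j, k, hj, hk, h⟩
    have : perspectiveCentre κ = twoLines α β (true, k) - κ • twoLines α β (false, j) := by
      ext x
      fin_cases x <;> simp [perspectiveCentre, twoLines, h]
    rw [this]
    exact sub_mem (Submodule.subset_span ⟨_, hk, rfl⟩)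
      (Submodule.smul_mem _ _ (Submodule.subset_span ⟨_, hj, rfl⟩))

variable {C W : Type*} [Fintype C] [AddCommGroup W] [Module K W]

theorem liftIndep_twoLines_iff [Nonempty C] {α β : Fin 3 → K} {κ : Bool → K}
    (hα : Function.Injective α) (hβ : Function.Injective β) (hκ : ∀ i, κ i ≠ 0)
    {w : Bool × C → W} (hw : ∀ i, ∑ c, w (i, c) = 0) {I : Set ((Bool × C) ⊕ (Bool × Fin 3))} :
    LiftIndep (K := K) (twoLines α β) (fun i ↦ perspectiveCentre (κ i)) w I ↔
      PlaneLiftIndep (fun B ↦ LinearIndepOn K w B) (fun i j k ↦ β k = κ i * α j) I := by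
  -- A full block has an element outside `B`, so at most two plane elements remain and the criterion
  -- for pairs applies.
  have hcard : ∀ B ⊆ Sum.inl ⁻¹' I, LinearIndepOn K w B →
      (Sum.inl ⁻¹' I \ B).ncard + (Sum.inr ⁻¹' I).ncard ≤ 3 → ∀ i, (∀ c, Sum.inl (i, c) ∈ I) →
      (Sum.inr ⁻¹' I).ncard ≤ 2 := by
    intro B hBI hB hle i hi
    obtain ⟨c, hc⟩ := exists_notMem_of_sum_eq_zero (hw i) (Classical.arbitrary C) hB
    have : 0 < (Sum.inl ⁻¹' I \ B).ncard := (ncard_pos).2 ⟨(i, c), hi c, hc⟩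
    omega
  constructor
  · rintro ⟨hy, ⟨B, hBI, hB, hle⟩, hq⟩
    rw [finrank_fin_fun] at hle
    exact ⟨(linearIndepOn_twoLines_iff hα hβ).1 hy, ⟨B, hBI, hB, hle⟩, fun i hi h ↦
      hq i hi ((perspectiveCentre_mem_span_iff (hκ i) (hcard B hBI hB hle i hi)).2 h)⟩
  · rintro ⟨hy, ⟨B, hBI, hB, hle⟩, hq⟩
    refine ⟨(linearIndepOn_twoLines_iff hα hβ).2 hy, ⟨B, hBI, hB, ?_⟩, fun i hi h ↦
      hq i hi ((perspectiveCentre_mem_span_iff (hκ i) (hcard B hBI hB hle i hi)).1 h)⟩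
    rwa [finrank_fin_fun]

end Configuration

/-! ### Representability under minors and relabelling -/

namespace Matroid

section Representable

variable {α τ F V : Type*} [Field F] [AddCommGroup V] [Module F V]

theorem isRepresentable_of_linearIndepOn [FiniteDimensional F V] {M : Matroid α} (v : α → V)
    (h : ∀ I ⊆ M.E, (M.Indep I ↔ LinearIndepOn F v I)) : M.IsRepresentable F := by
  refine ⟨finrank F V, (finBasis F V).equivFun ∘ v, fun I hI ↦ (h I hI).trans ?_⟩
  exact ((LinearMap.linearIndependent_iff (finBasis F V).equivFun.toLinearMap
    (LinearMap.ker_eq_bot.2 (finBasis F V).equivFun.injective)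
    (v := fun x : I ↦ v x))).symm

theorem IsRepresentable.delete {M : Matroid α} (h : M.IsRepresentable F) (D : Set α) :
    (M ＼ D).IsRepresentable F := by
  obtain ⟨n, v, hv⟩ := h
  refine ⟨n, v, fun I hI ↦ ?_⟩
  rw [delete_ground, subset_sdiff] at hI
  rw [delete_indep_iff, and_iff_left hI.2, hv I hI.1]

theorem IsRepresentable.contract {M : Matroid α} (h : M.IsRepresentable F) (C : Set α) :
    (M ／ C).IsRepresentable F := by
  obtain ⟨n, v, hv⟩ := h
  obtain ⟨B, hB⟩ := M.exists_isBasis' C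
  refine isRepresentable_of_linearIndepOn ((Submodule.span F (v '' B)).mkQ ∘ v) fun I hI ↦ ?_
  rw [contract_ground, subset_sdiff] at hI
  have hBE := hB.indep.subset_ground
  have hdisj : Disjoint B I := (hI.2.mono_right hB.subset).symm
  rw [hB.contract_indep_iff, and_iff_left hI.2.symm, union_comm, hv _ (union_subset hBE hI.1),
    ((hv B hBE).1 hB.indep).quotient_iff_union hdisj]

theorem IsRepresentable.of_isMinor {M N : Matroid α} (h : M.IsRepresentable F) (hN : N ≤m M) :
    N.IsRepresentable F := by
  obtain ⟨C, D, rfl⟩ := hN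
  exact (h.contract C).delete D

theorem IsRepresentable.of_mapEmbedding {M : Matroid τ} {g : τ ↪ α}
    (h : (M.mapEmbedding g).IsRepresentable F) : M.IsRepresentable F := by
  obtain ⟨n, v, hv⟩ := h
  refine ⟨n, v ∘ g, fun I hI ↦ ?_⟩
  have := hv (g '' I) (image_mono hI)
  rw [mapEmbedding_indep_iff, preimage_image_eq _ g.injective,
    and_iff_left (image_subset_range _ _)] at this
  exact this.trans ⟨fun h ↦ h.comp_of_image g.injective.injOn, fun h ↦ h.image_of_comp _ _⟩

theorem IsRepresentable.mapEmbedding {M : Matroid τ} (h : M.IsRepresentable F) (g : τ ↪ α) :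
    (M.mapEmbedding g).IsRepresentable F := by
  obtain ⟨n, v, hv⟩ := h
  refine ⟨n, Function.extend g v 0, fun I hI ↦ ?_⟩
  obtain ⟨J, hJ, rfl⟩ := subset_image_iff.1 (show I ⊆ g '' M.E from hI)
  rw [mapEmbedding_indep_iff, preimage_image_eq _ g.injective,
    and_iff_left (image_subset_range _ _), hv J hJ]
  have : v = Function.extend g v 0 ∘ g := 
    funext fun x ↦ (g.injective.extend_apply v 0 x).symm
  nth_rewrite 1 [this]
  exact ⟨fun h ↦ h.image_of_comp _ _, fun h ↦ h.comp_of_image g.injective.injOn⟩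

/-- Deletion sees only the sets avoiding `e`, so `M` may be replaced by a representable matroid
agreeing with it there. The next lemma is the analogue for contraction and sets through `e`. -/
theorem IsRepresentable.delete_of_indep_iff {M M' : Matroid α} (h : M'.IsRepresentable F)
    (hE : M.E = M'.E) (e : α) (hI : ∀ I, e ∉ I → (M.Indep I ↔ M'.Indep I)) :
    (M ＼ {e}).IsRepresentable F := by
  convert h.delete {e} using 1
  refine ext_indep (by simp [hE]) fun I _ ↦ ?_
  rw [deleteElem_indep_iff, deleteElem_indep_iff]
  exact and_congr_left fun he ↦ hI I he

theorem IsRepresentable.contract_of_indep_iff {M M' : Matroid α} (h : M'.IsRepresentable F)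
    (hE : M.E = M'.E) (e : α) (he : M.Indep {e}) (hI : ∀ I, e ∈ I → (M.Indep I ↔ M'.Indep I)) :
    (M ／ {e}).IsRepresentable F := by
  convert h.contract {e} using 1
  have he' : M'.Indep {e} := (hI {e} rfl).1 he
  refine ext_indep (by simp [hE]) fun I _ ↦ ?_
  rw [he.contract_indep_iff, he'.contract_indep_iff]
  exact and_congr_right fun _ ↦ hI _ (Or.inr rfl)

/-- The matroid of linear independence on a finite family of vectors. -/
def vectorMatroid (F : Type*) [Field F] [Module F V] [Finite τ] (v : τ → V) : Matroid τ :=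
  (IndepMatroid.ofFinite (E := univ) finite_univ (fun I ↦ LinearIndepOn F v I)
    (linearIndepOn_empty F v) (fun _ _ h hIJ ↦ h.mono hIJ)
    (fun I J hI hJ hlt ↦ by
      by_contra! hcon
      have hsub : v '' J ⊆ Submodule.span F (v '' I) := by
        rintro _ ⟨x, hx, rfl⟩
        by_cases hxI : x ∈ I
        · exact Submodule.subset_span ⟨x, hxI, rfl⟩
        · by_contra hx'
          exact hcon x hx hxI (hI.insert hx')
      have : FiniteDimensional F (Submodule.span F (v '' I)) :=
        FiniteDimensional.span_of_finite F (toFinite _)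
      have hle := Submodule.finrank_mono (Submodule.span_le.2 hsub)
      have hcard : ∀ S : Set τ, LinearIndepOn F v S →
          finrank F (Submodule.span F (v '' S)) = S.ncard := by
        intro S hS
        have := Fintype.ofFinite S
        rw [image_eq_range, ← Nat.card_coe_set_eq, Nat.card_eq_fintype_card]
        exact finrank_span_eq_card hS.linearIndependent
      rw [hcard I hI, hcard J hJ] at hle
      omega)
    (fun _ _ ↦ subset_univ _)).matroid

@[simp] theorem vectorMatroid_ground [Finite τ] (v : τ → V) : (vectorMatroid F v).E = univ := rfl

@[simp] theorem vectorMatroid_indep_iff [Finite τ] {v : τ → V} {I : Set τ} :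
    (vectorMatroid F v).Indep I ↔ LinearIndepOn F v I := Iff.rfl

theorem vectorMatroid_isRepresentable [Finite τ] [FiniteDimensional F V] (v : τ → V) :
    (vectorMatroid F v).IsRepresentable F :=
  isRepresentable_of_linearIndepOn v fun _ _ ↦ Iff.rfl

end Representable

end Matroid

/-! ### Two perspectivities force a root of `X ^ 2 + X + 1` -/

section Perspective

variable {K V : Type*} [Field K] [AddCommGroup V] [Module K V]

/-- Two perspectivities between triples on two lines whose composition permutes the first triple
cyclically give a root of `X ^ 2 + X + 1`. -/
theorem exists_root_of_translates {A B : Fin 3 → V} {g g' : V} {σ τ : Fin 3 → K}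
    (hAB : ∀ j, B j = A j + g) (h : ∀ j, τ j • B (j + 1) - σ j • A j = g') (hτ : τ 0 ≠ 0)
    (hA : g ∉ Submodule.span K (range A)) (hB : g ∉ Submodule.span K (range B))
    (hne : A 1 ≠ A 0) : ∃ κ : K, κ ^ 2 + κ + 1 = 0 := by
  have hAmem : ∀ j, A j ∈ Submodule.span K (range A) := fun j ↦ Submodule.subset_span ⟨j, rfl⟩
  have hBmem : ∀ j, B j ∈ Submodule.span K (range B) := fun j ↦ Submodule.subset_span ⟨j, rfl⟩
  -- Comparing the relations for `j` and `0` puts `(τ j - τ 0) • g` in the span of `A`, which does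
  -- not contain `g`. The same works for `σ` and `B`.
  have hτj : ∀ j, τ j = τ 0 := by
    intro j
    by_contra hj
    refine hA ((Submodule.smul_mem_iff _ (sub_ne_zero.2 hj)).1 ?_)
    have : (τ j - τ 0) • g =
        τ 0 • A (0 + 1) - σ 0 • A 0 - (τ j • A (j + 1) - σ j • A j) := by
      have := (h j).trans (h 0).symm
      rw [hAB, hAB] at this
      linear_combination (norm := module) this
    rw [this]
    exact sub_mem (sub_mem (Submodule.smul_mem _ _ (hAmem _)) (Submodule.smul_mem _ _ (hAmem _)))
      (sub_mem (Submodule.smul_mem _ _ (hAmem _)) (Submodule.smul_mem _ _ (hAmem _)))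
  have hσj : ∀ j, σ j = σ 0 := by
    intro j
    by_contra hj
    refine hB ((Submodule.smul_mem_iff _ (sub_ne_zero.2 hj)).1 ?_)
    have : (σ j - σ 0) • g =
        τ 0 • B (0 + 1) - σ 0 • B 0 - (τ j • B (j + 1) - σ j • B j) := by
      have := (h j).trans (h 0).symm
      linear_combination (norm := module) this - σ j • hAB j + σ 0 • hAB 0
    rw [this]
    exact sub_mem (sub_mem (Submodule.smul_mem _ _ (hBmem _)) (Submodule.smul_mem _ _ (hBmem _)))
      (sub_mem (Submodule.smul_mem _ _ (hBmem _)) (Submodule.smul_mem _ _ (hBmem _)))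
  have h0 := h 0
  have h1 := h 1
  have h2 := h 2
  simp only [hAB, hτj 1, hτj 2, hσj 1, hσj 2, show (0 : Fin 3) + 1 = 1 from rfl,
    show (1 : Fin 3) + 1 = 2 from rfl, show (2 : Fin 3) + 1 = 0 from rfl] at h0 h1 h2
  refine ⟨σ 0 / τ 0, ?_⟩
  have hD1 : A 2 - A 1 = (σ 0 / τ 0) • (A 1 - A 0) := by
    have : τ 0 • (A 2 - A 1) = σ 0 • (A 1 - A 0) := by
      linear_combination (norm := module) h1 - h0
    rw [div_eq_inv_mul, mul_smul, ← this, smul_smul, inv_mul_cancel₀ hτ, one_smul]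
  have hD2 : A 0 - A 2 = (σ 0 / τ 0) • (A 2 - A 1) := by
    have : τ 0 • (A 0 - A 2) = σ 0 • (A 2 - A 1) := by
      linear_combination (norm := module) h2 - h1
    rw [div_eq_inv_mul, mul_smul, ← this, smul_smul, inv_mul_cancel₀ hτ, one_smul]
  -- The three cyclic differences of `A` add up to zero, and each is `σ 0 / τ 0` times the one
  -- before.
  have : ((σ 0 / τ 0) ^ 2 + σ 0 / τ 0 + 1) • (A 1 - A 0) = 0 := by
    rw [hD1] at hD2
    linear_combination (norm := module) -hD1 - hD2
  exact (smul_eq_zero.1 this).resolve_right (sub_ne_zero.2 hne)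

/-- Rescaling the points of both triples turns the first perspectivity into translation by `g`. -/
theorem exists_root_of_perspectives {a b : Fin 3 → V} {g g' : V} {s t s' t' : Fin 3 → K}
    (hs : ∀ j, s j ≠ 0) (ht : ∀ j, t j ≠ 0) (ht' : ∀ j, t' j ≠ 0)
    (h : ∀ j, t j • b j - s j • a j = g) (h' : ∀ j, t' j • b (j + 1) - s' j • a j = g')
    (hb : b 0 ∉ Submodule.span K (range a)) (ha : a 0 ∉ Submodule.span K (range b))
    (hne : LinearIndependent K ![a 0, a 1]) : ∃ κ : K, κ ^ 2 + κ + 1 = 0 := by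
  have hA : ∀ j, s j • a j ∈ Submodule.span K (range a) := fun j ↦
    Submodule.smul_mem _ _ (Submodule.subset_span ⟨j, rfl⟩)
  have hB : ∀ j, t j • b j ∈ Submodule.span K (range b) := fun j ↦
    Submodule.smul_mem _ _ (Submodule.subset_span ⟨j, rfl⟩)
  refine exists_root_of_translates (A := fun j ↦ s j • a j) (B := fun j ↦ t j • b j) (g := g)
    (g' := g') (τ := fun j ↦ t' j / t (j + 1)) (σ := fun j ↦ s' j / s j)
    (fun j ↦ by rw [← h j]; abel)
    (fun j ↦ by rw [smul_smul, smul_smul, div_mul_cancel₀ _ (ht _), div_mul_cancel₀ _ (hs _), h'])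
    (div_ne_zero (ht' _) (ht _)) (fun hg ↦ hb ?_) (fun hg ↦ ha ?_) (fun heq ↦ ?_)
  · have hg' : g ∈ Submodule.span K (range a) :=
      Submodule.span_le.2 (range_subset_iff.2 hA) hg
    rw [← h 0] at hg'
    exact (Submodule.smul_mem_iff _ (ht 0)).1 (by simpa using add_mem hg' (hA 0))
  · have hg' : g ∈ Submodule.span K (range b) :=
      Submodule.span_le.2 (range_subset_iff.2 hB) hg
    rw [← h 0] at hg'
    exact (Submodule.smul_mem_iff _ (hs 0)).1 (by simpa using sub_mem (hB 0) hg')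
  · rw [LinearIndependent.pair_iff] at hne
    have := hne (s 0) (-s 1) (by rw [neg_smul, ← sub_eq_add_neg, sub_eq_zero]; exact heq.symm)
    exact hs 0 this.1

end Perspective

section Perspective

variable {K V C : Type*} [Field K] [AddCommGroup V] [Module K V]
  {ind : Set (Bool × C) → Prop} {rel : Bool → Fin 3 → Fin 3 → Prop}
  {v : (Bool × C) ⊕ (Bool × Fin 3) → V}

theorem PlaneLiftIndep.empty_sum {J : Set (Bool × Fin 3)} [Nonempty C] (h0 : ind ∅) :
    PlaneLiftIndep ind rel (Sum.inr '' J : Set ((Bool × C) ⊕ (Bool × Fin 3))) ↔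
      J.ncard ≤ 3 ∧ ∀ s, ∃ j, (s, j) ∉ J := by
  have h1 : (Sum.inr ⁻¹' (Sum.inr '' J : Set ((Bool × C) ⊕ (Bool × Fin 3)))) = J :=
    preimage_image_eq _ Sum.inr_injective
  unfold PlaneLiftIndep
  simp only [h1, mem_image, Sum.inr.injEq, exists_eq_right, preimage_inl_image_inr,
    subset_empty_iff, exists_eq_left, sdiff_self, reduceCtorEq, and_false, exists_false]
  constructor
  · exact fun h ↦ h.1
  · intro h
    refine ⟨h, ⟨h0, by simpa using h.1⟩, fun i hi ↦ (hi (Classical.arbitrary C)).elim⟩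

/-- A block exceeds its independent part by one, so up to two plane elements still fit into the
allowance of three. -/
theorem PlaneLiftIndep.block_union {J : Set (Bool × Fin 3)} {i : Bool}
    (hind : ∃ c : C, ind {x | x.1 = i ∧ x.2 ≠ c}) (hJ : J.ncard ≤ 2)
    (hrel : ∀ j k, (false, j) ∈ J → (true, k) ∈ J → ¬ rel i j k) :
    PlaneLiftIndep ind rel (Sum.inl '' {x | x.1 = i} ∪ Sum.inr '' J) := by
  have h1 : (Sum.inr ⁻¹' (Sum.inl '' {x : Bool × C | x.1 = i} ∪ Sum.inr '' J)) = J := by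
    ext x; simp
  have h2 : (Sum.inl ⁻¹' (Sum.inl '' {x : Bool × C | x.1 = i} ∪ Sum.inr '' J)) =
      {x | x.1 = i} := by
    ext x; simp
  obtain ⟨c, hc⟩ := hind
  unfold PlaneLiftIndep
  rw [h1, h2]
  refine ⟨⟨by omega, fun s ↦ ?_⟩, ⟨_, fun x hx ↦ hx.1, hc, ?_⟩, fun k hk ↦ ?_⟩
  · by_contra! hcon
    have hsub : Prod.mk s '' univ ⊆ J := by
      rintro _ ⟨j, -, rfl⟩
      simpa using hcon j
    have := ncard_le_ncard hsub
    rw [ncard_image_of_injective _ (Prod.mk_right_injective s), ncard_univ] at this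
    simp at this
    omega
  · have : {x : Bool × C | x.1 = i} \ {x | x.1 = i ∧ x.2 ≠ c} ⊆ {(i, c)} := by
      rintro ⟨k, d⟩ ⟨hk, hd⟩
      simp at hk hd ⊢
      exact ⟨hk, hd hk⟩
    have := ncard_le_ncard this
    rw [ncard_singleton] at this
    omega
  · have : k = i := by simpa using hk c
    subst this
    exact fun ⟨j, l, hj, hl, hr⟩ ↦ hrel j l (by simpa using hj) (by simpa using hl) hr

theorem PlaneLiftIndep.not_block_union_pair {i : Bool} {j k : Fin 3} (hrel : rel i j k) :
    ¬ PlaneLiftIndep ind rel (Sum.inl '' {x : Bool × C | x.1 = i} ∪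
      Sum.inr '' {(false, j), (true, k)}) :=
  fun h ↦ h.2.2 i (by simp) ⟨j, k, by simp, by simp, hrel⟩

theorem finrank_span_image_eq_ncard {τ : Type*} [Finite τ] {v : τ → V} {S : Set τ}
    (h : LinearIndepOn K v S) : finrank K (Submodule.span K (v '' S)) = S.ncard := by
  have := Fintype.ofFinite S
  rw [image_eq_range, ← Nat.card_coe_set_eq, Nat.card_eq_fintype_card]
  exact finrank_span_eq_card h.linearIndependent

theorem finrank_plane_le [Fintype C] [Nonempty C]
    (h : ∀ I, LinearIndepOn K v I ↔ PlaneLiftIndep ind rel I) (h0 : ind ∅) :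
    finrank K (Submodule.span K (range fun x ↦ v (Sum.inr x))) ≤ 3 := by
  let J : Set (Bool × Fin 3) := {(false, 0), (false, 1), (true, 0)}
  have hJ : J.ncard = 3 := by
    rw [ncard_eq_three]
    exact ⟨_, _, _, by simp, by simp, by simp, rfl⟩
  have hJi : LinearIndepOn K v (Sum.inr '' J) := by
    rw [h, PlaneLiftIndep.empty_sum h0]
    refine ⟨hJ.le, fun s ↦ ⟨2, by simp [J]⟩⟩
  have hle : Submodule.span K (range fun x ↦ v (Sum.inr x)) ≤
      Submodule.span K (v '' (Sum.inr '' J)) := by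
    rw [Submodule.span_le]
    rintro _ ⟨x, rfl⟩
    by_contra hx
    have hins := hJi.insert hx
    have hxJ : x ∉ J := fun hxJ ↦ hx (Submodule.subset_span ⟨_, ⟨x, hxJ, rfl⟩, rfl⟩)
    rw [← image_insert_eq, h, PlaneLiftIndep.empty_sum h0, ncard_insert_of_notMem hxJ, hJ] at hins
    omega
  have := FiniteDimensional.span_of_finite K (toFinite (v '' (Sum.inr '' J)))
  refine (Submodule.finrank_mono hle).trans ?_
  rw [finrank_span_image_eq_ncard hJi, ncard_image_of_injective _ Sum.inr_injective, hJ]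

/-- The spans of the block and of the plane meet in dimension at most one. A related pair is
dependent together with the block although each of its points alone is not, so it yields a nonzero
vector in that intersection. All these vectors are therefore proportional. -/
theorem exists_perspective [Fintype C] [Nonempty C]
    (h : ∀ I, LinearIndepOn K v I ↔ PlaneLiftIndep ind rel I) (h0 : ind ∅) {i : Bool}
    (hind : ∃ c : C, ind {x | x.1 = i ∧ x.2 ≠ c}) (σ : Equiv.Perm (Fin 3))
    (hrel : ∀ j k, rel i j k ↔ k = σ j) :
    ∃ (g : V) (s t : Fin 3 → K), (∀ j, s j ≠ 0) ∧ (∀ j, t j ≠ 0) ∧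
      ∀ j, t j • v (Sum.inr (true, σ j)) - s j • v (Sum.inr (false, j)) = g := by
  classical
  set S := Submodule.span K (v '' (Sum.inl '' {x | x.1 = i})) with hS
  set P := Submodule.span K (range fun x ↦ v (Sum.inr x)) with hP
  have : FiniteDimensional K S := FiniteDimensional.span_of_finite K (toFinite _)
  have : FiniteDimensional K P := FiniteDimensional.span_of_finite K (toFinite _)
  have hPv : ∀ x, v (Sum.inr x) ∈ P := fun x ↦ Submodule.subset_span ⟨x, rfl⟩
  have hunion : ∀ J : Set (Bool × Fin 3), J.ncard ≤ 2 →
      (∀ j k, (false, j) ∈ J → (true, k) ∈ J → ¬ rel i j k) →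
      LinearIndepOn K v (Sum.inl '' {x : Bool × C | x.1 = i} ∪ Sum.inr '' J) :=
    fun J hJ hJr ↦ (h _).2 (.block_union hind hJ hJr)
  have hdim : finrank K (S ⊓ P : Submodule K V) ≤ 1 := by
    -- A full block and two unrelated plane elements are independent, while the plane has rank at
    -- most three.
    have hi := hunion {(false, 0), (true, σ 1)} (ncard_pair (by simp)).le (by
      intro j k hj hk
      simp only [mem_insert_iff, mem_singleton_iff, Prod.mk.injEq, true_and, Bool.false_eq_true,
        false_and, or_false, Bool.true_eq_false, false_or] at hj hk
      rw [hrel, hj, hk, σ.injective.eq_iff]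
      simp)
    have h1 := finrank_span_image_eq_ncard hi
    have hle : Submodule.span K (v '' (Sum.inl '' {x : Bool × C | x.1 = i} ∪
        Sum.inr '' {(false, 0), (true, σ 1)})) ≤ S ⊔ P := by
      rw [image_union, Submodule.span_union]
      refine sup_le_sup le_rfl (Submodule.span_le.2 ?_)
      rintro _ ⟨_, ⟨x, -, rfl⟩, rfl⟩
      exact hPv x
    have h2 := Submodule.finrank_mono hle
    have h3 := Submodule.finrank_sup_add_finrank_inf_eq S P
    have h4 := finrank_span_image_eq_ncard (hi.mono subset_union_left)
    have h5 := finrank_plane_le h h0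
    rw [← hS] at h4
    rw [← hP] at h5
    rw [ncard_union_eq (by
      rw [Set.disjoint_left]
      rintro _ ⟨x, -, rfl⟩ ⟨j, -, hj⟩
      cases hj), ncard_image_of_injective {(false, 0), (true, σ 1)} Sum.inr_injective,
      ncard_pair (by simp)] at h1
    omega
  have hpoint : ∀ j, ∃ s : K, s ≠ 0 ∧
      v (Sum.inr (true, σ j)) - s • v (Sum.inr (false, j)) ∈ S := by
    intro j
    have ha := hunion {(false, j)} (by simp) (by simp)
    have hb := hunion {(true, σ j)} (by simp) (by simp)
    rw [image_singleton, union_singleton] at ha hb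
    have hmem : v (Sum.inr (true, σ j)) ∈ Submodule.span K
        (v '' insert (Sum.inr (false, j)) (Sum.inl '' {x : Bool × C | x.1 = i})) := by
      by_contra hx
      have := ha.insert hx
      refine PlaneLiftIndep.not_block_union_pair ((hrel j _).2 rfl) ((h _).1 ?_)
      convert this using 1
      rw [image_pair, insert_comm]
      ext x
      simp
    rw [image_insert_eq, Submodule.mem_span_insert] at hmem
    obtain ⟨s, z, hz, hsz⟩ := hmem
    refine ⟨s, fun hs ↦ ?_, by rw [hsz]; simpa using hz⟩
    rw [hs, zero_smul, zero_add] at hsz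
    exact hb.notMem_span_of_insert (by simp) (hsz ▸ hz)
  choose s hs hsS using hpoint
  have hne : ∀ j, v (Sum.inr (true, σ j)) - s j • v (Sum.inr (false, j)) ≠ 0 := by
    intro j hj
    have hi : LinearIndepOn K v (Sum.inr '' {(false, j), (true, σ j)}) := by
      rw [h, PlaneLiftIndep.empty_sum h0]
      refine ⟨(ncard_pair (by simp)).le.trans (by norm_num), fun t ↦ ?_⟩
      by_contra! hcon
      have h1 := hcon (j + 1)
      have h2 := hcon (σ j + 1)
      cases t <;> simp at h1 h2
    rw [image_pair, LinearIndepOn.pair_iff _ (by simp)] at hi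
    exact one_ne_zero (hi (-s j) 1 (by rw [one_smul, neg_smul, neg_add_eq_sub, hj])).2
  have hmem : ∀ j, v (Sum.inr (true, σ j)) - s j • v (Sum.inr (false, j)) ∈ S ⊓ P := fun j ↦
    ⟨hsS j, sub_mem (hPv _) (Submodule.smul_mem _ _ (hPv _))⟩
  have hscale : ∀ j, ∃ r : K, r • (v (Sum.inr (true, σ j)) - s j • v (Sum.inr (false, j))) =
      v (Sum.inr (true, σ 0)) - s 0 • v (Sum.inr (false, 0)) := by
    intro j
    obtain ⟨⟨u, hu⟩, huS⟩ := finrank_le_one_iff.1 hdim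
    obtain ⟨r, hr⟩ := huS ⟨_, hmem j⟩
    obtain ⟨r', hr'⟩ := huS ⟨_, hmem 0⟩
    have hr := congrArg Subtype.val hr
    have hr' := congrArg Subtype.val hr'
    simp only [Submodule.coe_smul] at hr hr'
    have hr0 : r ≠ 0 := fun hr0 ↦ hne j (by rw [← hr, hr0, zero_smul])
    exact ⟨r' / r, by rw [← hr, ← hr', smul_smul, div_mul_cancel₀ _ hr0]⟩
  choose r hr using hscale
  have hr0 : ∀ j, r j ≠ 0 := fun j hj ↦ hne 0 (by rw [← hr j, hj, zero_smul])
  exact ⟨v (Sum.inr (true, σ 0)) - s 0 • v (Sum.inr (false, 0)), fun j ↦ r j * s j, r,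
    fun j ↦ mul_ne_zero (hr0 j) (hs j), hr0,
    fun j ↦ by rw [← hr j, smul_sub, smul_smul]⟩

/-- A representation of the lift whose collinearities are two perspectivities composing to a
cyclic shift yields a root of `X ^ 2 + X + 1`. -/
theorem exists_root_of_planeLiftIndep [Fintype C] [Nonempty C]
    (h : ∀ I, LinearIndepOn K v I ↔ PlaneLiftIndep ind rel I) (h0 : ind ∅)
    (hind : ∀ i, ∃ c : C, ind {x | x.1 = i ∧ x.2 ≠ c}) (hrel : ∀ j k, rel false j k ↔ k = j)
    (hrel' : ∀ j k, rel true j k ↔ k = j + 1) : ∃ κ : K, κ ^ 2 + κ + 1 = 0 := by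
  obtain ⟨g, s, t, hs, ht, hg⟩ := exists_perspective h h0 (hind false) (Equiv.refl _) hrel
  obtain ⟨g', s', t', -, ht', hg'⟩ :=
    exists_perspective h h0 (hind true) (Equiv.addRight 1) hrel'
  have hplane : ∀ J : Set (Bool × Fin 3), LinearIndepOn K v (Sum.inr '' J) ↔
      J.ncard ≤ 3 ∧ ∀ s, ∃ j, (s, j) ∉ J := fun J ↦ by rw [h, PlaneLiftIndep.empty_sum h0]
  have hoff : ∀ e : Bool,
      v (Sum.inr (!e, 0)) ∉ Submodule.span K (range fun j ↦ v (Sum.inr (e, j))) := by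
    intro e hmem
    have h1 : LinearIndepOn K v (Sum.inr '' {(e, 0), (e, 1)}) :=
      (hplane _).2 ⟨(ncard_pair (by simp)).le.trans (by norm_num), fun t ↦ ⟨2, by simp⟩⟩
    have h2 : LinearIndepOn K v (Sum.inr '' {(!e, 0), (e, 0), (e, 1)}) := by
      refine (hplane _).2 ⟨?_, fun t ↦ ⟨2, by simp⟩⟩
      exact (ncard_eq_three.2 ⟨_, _, _, by simp, by simp, by simp, rfl⟩).le
    rw [image_insert_eq] at h2
    refine h2.notMem_span_of_insert (by cases e <;> simp) (Submodule.span_le.2 ?_ hmem)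
    rintro _ ⟨j, rfl⟩
    by_contra hj
    have h3 := h1.insert hj
    rw [← image_insert_eq, hplane] at h3
    obtain ⟨k, hk⟩ := h3.2 e
    have hj0 : j ≠ 0 := by
      rintro rfl
      exact hj (Submodule.subset_span ⟨_, ⟨(e, 0), by simp, rfl⟩, rfl⟩)
    have hj1 : j ≠ 1 := by
      rintro rfl
      exact hj (Submodule.subset_span ⟨_, ⟨(e, 1), by simp, rfl⟩, rfl⟩)
    have hj2 : j = 2 := by omega
    subst hj2
    fin_cases k <;> simp at hk
  refine exists_root_of_perspectives (a := fun j ↦ v (Sum.inr (false, j)))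
    (b := fun j ↦ v (Sum.inr (true, j))) hs ht ht' hg hg' (hoff false) (hoff true) ?_
  have h1 : LinearIndepOn K v (Sum.inr '' {(false, 0), (false, 1)}) :=
    (hplane _).2 ⟨(ncard_pair (by simp)).le.trans (by norm_num), fun t ↦ ⟨2, by simp⟩⟩
  rw [image_pair, LinearIndepOn.pair_iff _ (by simp)] at h1
  exact LinearIndependent.pair_iff.2 fun a b hab ↦ h1 a b hab

end Perspective

/-! ### Complex and real realizations -/

section Representations

variable {ι : Type*} [Fintype ι]

/-- Two bases, each extended by the vector that makes its sum zero. -/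
noncomputable def blockVectors (b : Bool → Basis ι ℝ (ι → ℝ)) : Bool × Option ι → ι → ℝ
  | (i, some x) => b i x
  | (i, none) => -∑ x, b i x

theorem sum_blockVectors (b : Bool → Basis ι ℝ (ι → ℝ)) (i : Bool) :
    ∑ c, blockVectors b (i, c) = 0 := by
  rw [Fintype.sum_option]
  simp [blockVectors]

/-- Independence of the vectors of two bases, each extended by the vector that makes its sum
zero. -/
def BlockIndep (b : Bool → Basis ι ℝ (ι → ℝ)) (B : Set (Bool × Option ι)) : Prop :=
  LinearIndepOn ℝ (blockVectors b) B

theorem BlockIndep.ncard_le {b : Bool → Basis ι ℝ (ι → ℝ)} {B : Set (Bool × Option ι)}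
    (h : BlockIndep b B) : B.ncard ≤ Fintype.card ι := by
  classical
  have := LinearIndependent.fintype_card_le_finrank (R := ℝ) (LinearIndepOn.linearIndependent h)
  rwa [← Nat.card_eq_fintype_card, Nat.card_coe_set_eq, finrank_fintype_fun_eq_card] at this

theorem blockIndep_empty (b : Bool → Basis ι ℝ (ι → ℝ)) : BlockIndep b ∅ :=
  linearIndepOn_empty ℝ _

theorem blockIndep_of_ne_none (b : Bool → Basis ι ℝ (ι → ℝ)) (i : Bool) :
    BlockIndep b {x | x.1 = i ∧ x.2 ≠ none} := by
  have : {x : Bool × Option ι | x.1 = i ∧ x.2 ≠ none} = (fun y ↦ (i, some y)) '' univ := by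
    ext ⟨k, _ | x⟩ <;> simp [eq_comm]
  rw [BlockIndep, this]
  refine LinearIndepOn.image_of_comp _ _ ?_
  exact linearIndepOn_univ_iff.2 (b i).linearIndependent

/-- Extending scalars preserves independence of the real block vectors, so the same `BlockIndep b`
governs lifts over ℝ and over ℂ. -/
theorem exists_vectors_planeLiftIndep {K : Type*} [Field K] [Algebra ℝ K]
    (b : Bool → Basis ι ℝ (ι → ℝ)) (hι : 2 ≤ Fintype.card ι) {α β : Fin 3 → K} {κ : Bool → K}
    (hα : Function.Injective α) (hβ : Function.Injective β) (hκ : ∀ i, κ i ≠ 0) :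
    ∃ v : (Bool × Option ι) ⊕ (Bool × Fin 3) → (Fin 3 → K) × (ι → K), ∀ I,
      LinearIndepOn K v I ↔ PlaneLiftIndep (BlockIndep b) (fun i j k ↦ β k = κ i * α j) I := by
  classical
  have : Infinite K := Infinite.of_injective _ (algebraMap ℝ K).injective
  let w : Bool × Option ι → ι → K := fun x ↦ algebraMap ℝ K ∘ blockVectors b x
  have hw : ∀ i, ∑ c, w (i, c) = 0 := by
    intro i
    ext x
    have := congrFun (sum_blockVectors b i) x
    rw [Finset.sum_apply] at this ⊢
    simp only [w, Function.comp_apply, ← map_sum, this, Pi.zero_apply, map_zero]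
  have hind : BlockIndep b = fun B ↦ LinearIndepOn K w B := by
    ext B
    exact (linearIndependent_algebraMap_comp_iff
      (v := fun x : B ↦ blockVectors b x)).symm
  obtain ⟨p, hp⟩ := exists_generic_lift (twoLines α β) (fun i ↦ perspectiveCentre (κ i)) hw (by
    rw [finrank_fintype_fun_eq_card, finrank_fin_fun, Fintype.card_option]
    omega)
  refine ⟨_, fun I ↦ (hp I).trans ?_⟩
  rw [hind]
  exact liftIndep_twoLines_iff hα hβ hκ hw

/-- Under `hI` the constraint of the other block is vacuous: if that block lies in `I`, so does an
element of block `i`, at least two elements fall outside `B`, and no room is left for a pair of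
plane elements. -/
theorem PlaneLiftIndep.of_rel {C : Type*} [Fintype C] {ind : Set (Bool × C) → Prop}
    {rel rel' : Bool → Fin 3 → Fin 3 → Prop} {I : Set ((Bool × C) ⊕ (Bool × Fin 3))}
    (hind : ∀ B, ind B → B.ncard < Fintype.card C) (i : Bool)
    (hrel : ∀ j k, rel' i j k → rel i j k)
    (hI : (∀ c, Sum.inl (!i, c) ∈ I) → ∃ c, Sum.inl (i, c) ∈ I)
    (h : PlaneLiftIndep ind rel I) : PlaneLiftIndep ind rel' I := by
  obtain ⟨hY, ⟨B, hBI, hB, hle⟩, hq⟩ := h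
  refine ⟨hY, ⟨B, hBI, hB, hle⟩, fun k hk ↦ ?_⟩
  by_cases hki : k = i
  · subst hki
    rintro ⟨j, l, hj, hl, hjl⟩
    exact hq k hk ⟨j, l, hj, hl, hrel j l hjl⟩
  · obtain rfl : k = !i := by cases k <;> cases i <;> simp_all
    obtain ⟨c₀, hc₀⟩ := hI hk
    rintro ⟨j, l, hj, hl, -⟩
    have h1 : 2 ≤ (Sum.inr ⁻¹' I).ncard := by
      rw [← ncard_pair (show ((false, j) : Bool × Fin 3) ≠ (true, l) by simp)]
      exact ncard_le_ncard (insert_subset hj (singleton_subset_iff.2 hl))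
    have h2 : Fintype.card C + 1 ≤ (Sum.inl ⁻¹' I).ncard := by
      have hsub : insert (i, c₀) (Prod.mk (!i) '' univ) ⊆ Sum.inl ⁻¹' I := by
        refine insert_subset hc₀ ?_
        rintro _ ⟨c, -, rfl⟩
        exact hk c
      have := ncard_le_ncard hsub
      rwa [ncard_insert_of_notMem (by simp),
        ncard_image_of_injective _ (Prod.mk_right_injective _), ncard_univ,
        Nat.card_eq_fintype_card] at this
    have h3 := hind B hB
    have h4 : (Sum.inl ⁻¹' I \ B).ncard + B.ncard = (Sum.inl ⁻¹' I).ncard :=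
      ncard_sdiff_add_ncard_of_subset hBI
    omega

/-- The collinearities of two perspectivities whose composition is a cyclic shift. -/
def cyclicRel (i : Bool) (j k : Fin 3) : Prop := k = j + cond i 1 0

/-- On the cube roots of unity, multiplication by `1` and by `ω` acts as the identity and as the
cyclic shift. -/
theorem exists_complex_planeLiftIndep_cyclicRel (b : Bool → Basis ι ℝ (ι → ℝ))
    (hι : 2 ≤ Fintype.card ι) :
    ∃ v : (Bool × Option ι) ⊕ (Bool × Fin 3) → (Fin 3 → ℂ) × (ι → ℂ), ∀ I,
      LinearIndepOn ℂ v I ↔ PlaneLiftIndep (BlockIndep b) cyclicRel I := by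
  obtain ⟨ω, hω⟩ : ∃ ω : ℂ, IsPrimitiveRoot ω 3 := ⟨_, Complex.isPrimitiveRoot_exp 3 (by simp)⟩
  have hinj : Function.Injective fun j : Fin 3 ↦ ω ^ (j : ℕ) := fun j k hjk ↦
    Fin.ext (hω.pow_inj j.2 k.2 hjk)
  obtain ⟨v, hv⟩ := exists_vectors_planeLiftIndep b hι hinj hinj (κ := fun i ↦ cond i ω 1)
    (by rintro (_ | _) <;> simp [hω.ne_zero])
  refine ⟨v, fun I ↦ (hv I).trans ?_⟩
  have : (fun (i : Bool) (j k : Fin 3) ↦ ω ^ (k : ℕ) = cond i ω 1 * ω ^ (j : ℕ)) = cyclicRel := by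
    ext i j k
    have : cond i ω 1 * ω ^ (j : ℕ) = ω ^ ((j + cond i 1 0 : Fin 3) : ℕ) := by
      have h3 := hω.pow_eq_one
      cases i
      · simp
      · fin_cases j
        · simp
        · simp [pow_two]
        · simpa [← pow_succ'] using h3
    rw [this]
    exact hinj.eq_iff
  rw [this]

/-- Relabelling the second triple by the shift turns one perspectivity into the identity, so any
three distinct reals serve, with both centres equal. -/
theorem exists_real_planeLiftIndep (b : Bool → Basis ι ℝ (ι → ℝ))
    (hι : 2 ≤ Fintype.card ι) (i : Bool) :
    ∃ v : (Bool × Option ι) ⊕ (Bool × Fin 3) → (Fin 3 → ℝ) × (ι → ℝ), ∀ I,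
      LinearIndepOn ℝ v I ↔ PlaneLiftIndep (BlockIndep b) (fun _ ↦ cyclicRel i) I := by
  have hinj : Function.Injective fun j : Fin 3 ↦ ((j : ℕ) : ℝ) :=
    Nat.cast_injective.comp Fin.val_injective
  obtain ⟨v, hv⟩ := exists_vectors_planeLiftIndep b hι hinj
    (hinj.comp (sub_left_injective (b := cond i 1 0))) (κ := fun _ ↦ 1) (by simp)
  refine ⟨v, fun I ↦ (hv I).trans ?_⟩
  have : (fun (_ : Bool) (j k : Fin 3) ↦ ((fun j : Fin 3 ↦ ((j : ℕ) : ℝ)) ∘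
      fun k ↦ k - cond i 1 0) k = 1 * ((j : ℕ) : ℝ)) = fun _ ↦ cyclicRel i := by
    ext _ j k
    rw [one_mul]
    exact hinj.eq_iff.trans sub_eq_iff_eq_add
  rw [this]

end Representations

/-! ### Excluded minors and the elements they keep -/

namespace Matroid

variable {α F : Type*} [Field F]

theorem exists_isExcludedMinorFor_isMinor {M : Matroid α} (hM : M.Finite)
    (h : ¬ M.IsRepresentable F) : ∃ N, N ≤m M ∧ N.IsExcludedMinorFor F := by
  obtain ⟨N, ⟨hNM, hN⟩, hmin⟩ := (measure fun N : Matroid α ↦ N.E.ncard).wf.has_min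
    {N | N ≤m M ∧ ¬ N.IsRepresentable F} ⟨M, .refl, h⟩
  have hfin : N.E.Finite := hM.ground_finite.subset hNM.subset
  refine ⟨N, hNM, ⟨hfin⟩, hN, fun N' hN' ↦ ?_⟩
  by_contra hrep
  exact hmin N' ⟨hN'.isMinor.trans hNM, hrep⟩ (ncard_lt_ncard hN'.ssubset hfin)

/-- A lost element was deleted or contracted, and that operation can be performed first. -/
theorem mem_ground_of_isMinor_of_not_isRepresentable {M N : Matroid α} {e : α} (h : N ≤m M)
    (hN : ¬ N.IsRepresentable F) (he : e ∈ M.E) (hdel : (M ＼ {e}).IsRepresentable F)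
    (hcon : (M ／ {e}).IsRepresentable F) : e ∈ N.E := by
  obtain ⟨C, D, -, -, hCD, rfl⟩ := h.exists_eq_contract_delete_disjoint
  by_contra heN
  apply hN
  by_cases heC : e ∈ C
  · rw [← union_eq_self_of_subset_left (singleton_subset_iff.2 heC), ← contract_contract]
    exact (hcon.contract C).delete D
  · have heD : e ∈ D := by
      by_contra heD
      exact heN ⟨⟨he, heC⟩, heD⟩
    rw [contract_delete_comm _ hCD, ← union_eq_self_of_subset_left (singleton_subset_iff.2 heD),
      ← delete_delete]
    exact (hdel.delete D).contract C

end Matroid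

/-! ### Recovering a real matroid from the blocks -/

section LinearAlgebra

variable {K V τ : Type*} [Field K] [AddCommGroup V] [Module K V]

theorem linearIndepOn_of_ncard_le [Finite τ] {w : τ → V} {S L B : Set τ}
    (hL : w '' L ⊆ Submodule.span K (w '' S)) (hB : LinearIndepOn K w B) (hBS : B ⊆ S ∪ L)
    (hcard : S.ncard ≤ B.ncard) : LinearIndepOn K w S := by
  obtain ⟨B', hB'S, -, hspan, hB'⟩ :=
    exists_linearIndepOn_extension (linearIndepOn_empty K w) (empty_subset S)
  have hle : Submodule.span K (w '' B) ≤ Submodule.span K (w '' B') := by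
    have hS := Submodule.span_le.2 hspan
    refine Submodule.span_le.2 ((image_mono hBS).trans ?_)
    rw [image_union]
    exact union_subset hspan (hL.trans hS)
  have := FiniteDimensional.span_of_finite K (toFinite (w '' B'))
  have h1 := Submodule.finrank_mono hle
  rw [finrank_span_image_eq_ncard hB, finrank_span_image_eq_ncard hB'] at h1
  rwa [← eq_of_subset_of_ncard_le hB'S (hcard.trans h1)]

theorem exists_basis_span_image_eq {ι : Type*} [Finite ι] (e : Basis ι K V) (S : Submodule K V) :
    ∃ (b : Basis ι K V) (A : Set ι), Submodule.span K (b '' A) = S := by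
  have : FiniteDimensional K V := e.finiteDimensional_of_finite
  obtain ⟨T, hT⟩ := S.exists_isCompl
  let b := ((finBasis K S).prod (finBasis K T)).map (S.prodEquivOfIsCompl T hT)
  refine ⟨b.reindex (b.indexEquiv e), b.indexEquiv e '' range Sum.inl, ?_⟩
  have himage : (b.reindex (b.indexEquiv e)) '' (b.indexEquiv e '' range Sum.inl) =
      S.subtype '' range (finBasis K S) := by
    rw [image_image, ← range_comp, ← range_comp]
    congr 1
    ext x
    simp [b]
  rw [himage, Submodule.span_image, (finBasis K S).span_eq, Submodule.map_top,
    Submodule.range_subtype]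

end LinearAlgebra

section Minor

/-- Elements of `L` lie in the span of `S`, so `L` and `J` together exhaust the allowance of three
and `S` must itself be independent. Without `none` no block is full, so the collinearities play no
role. -/
theorem planeLiftIndep_union_iff {ι : Type*} [Fintype ι] {b : Bool → Basis ι ℝ (ι → ℝ)}
    {rel : Bool → Fin 3 → Fin 3 → Prop} {S L : Set (Bool × Option ι)} {J : Set (Bool × Fin 3)}
    (hSL : Disjoint S L) (hL : blockVectors b '' L ⊆ Submodule.span ℝ (blockVectors b '' S))
    (hnone : ∀ i, (i, none) ∉ S ∪ L) (hcard : L.ncard + J.ncard = 3)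
    (hJ : ∀ s, ∃ j, (s, j) ∉ J) :
    PlaneLiftIndep (BlockIndep b) rel (Sum.inl '' (S ∪ L) ∪ Sum.inr '' J) ↔ BlockIndep b S := by
  have h1 : (Sum.inr ⁻¹' (Sum.inl '' (S ∪ L) ∪ Sum.inr '' J)) = J := by
    ext x; simp
  have h2 : (Sum.inl ⁻¹' (Sum.inl '' (S ∪ L) ∪ Sum.inr '' J)) = S ∪ L := by
    ext x; simp
  unfold PlaneLiftIndep
  rw [h1, h2]
  constructor
  · rintro ⟨-, ⟨B, hBS, hB, hle⟩, -⟩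
    refine linearIndepOn_of_ncard_le hL hB hBS ?_
    have h3 : ((S ∪ L) \ B).ncard + B.ncard = (S ∪ L).ncard :=
      ncard_sdiff_add_ncard_of_subset hBS
    rw [ncard_union_eq hSL] at h3
    omega
  · intro hS
    refine ⟨⟨by omega, by simpa using hJ⟩, ⟨S, subset_union_left, hS, ?_⟩, fun i hi ↦ ?_⟩
    · have := ncard_le_ncard (show (S ∪ L) \ S ⊆ L from fun x hx ↦ hx.1.resolve_left hx.2)
      omega
    · exact (hnone i (by simpa using hi none)).elim

/-- Every real family of vectors is obtained by contraction from two bases. -/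
theorem exists_bases_blockIndep_iff {ι W : Type*} [Fintype ι] [AddCommGroup W] [Module ℝ W]
    (u : ι → W) :
    ∃ (b : Bool → Basis ι ℝ (ι → ℝ)) (A : Set ι),
      (∀ T, BlockIndep b ((fun x ↦ (true, some x)) '' A ∪ (fun x ↦ (false, some x)) '' T) ↔
        LinearIndepOn ℝ u T) ∧
      ∀ x, u x = 0 → blockVectors b (false, some x) ∈
        Submodule.span ℝ (blockVectors b '' ((fun x ↦ (true, some x)) '' A)) := by
  classical
  let π := Fintype.linearCombination ℝ u
  -- The standard basis maps to `u` under `π`, and contracting `A` factors out the kernel of `π`.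
  obtain ⟨b, A, hA⟩ := exists_basis_span_image_eq (Pi.basisFun ℝ ι) (LinearMap.ker π)
  let b' : Bool → Basis ι ℝ (ι → ℝ) := fun i ↦ cond i b (Pi.basisFun ℝ ι)
  have hspan : Submodule.span ℝ (blockVectors b' '' ((fun x ↦ (true, some x)) '' A)) =
      LinearMap.ker π := by
    rw [← hA, image_image]
    rfl
  have hπ : ∀ x, π (blockVectors b' (false, some x)) = u x := by
    intro x
    change π (Pi.basisFun ℝ ι x) = u x
    rw [Pi.basisFun_apply]
    simp [π, Fintype.linearCombination_apply_single]
  refine ⟨b', A, fun T ↦ ?_, fun x hx ↦ ?_⟩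
  · have hindA : LinearIndepOn ℝ (blockVectors b') ((fun x ↦ (true, some x)) '' A) :=
      LinearIndepOn.image_of_comp _ _ (b.linearIndepOn A)
    have hdisj : Disjoint ((fun x : ι ↦ (true, some x)) '' A) ((fun x ↦ (false, some x)) '' T) := by
      rw [Set.disjoint_left]
      rintro _ ⟨x, -, rfl⟩ ⟨y, -, hy⟩
      simp at hy
    rw [BlockIndep, ← hindA.quotient_iff_union hdisj, hspan]
    have hinj : Function.Injective (fun x : ι ↦ (false, some x)) := fun x y h ↦ by simpa using h
    have h1 : LinearIndepOn ℝ ((LinearMap.ker π).mkQ ∘ blockVectors b')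
        ((fun x ↦ (false, some x)) '' T) ↔
        LinearIndepOn ℝ (((LinearMap.ker π).mkQ ∘ blockVectors b') ∘ fun x ↦ (false, some x)) T :=
      ⟨fun h ↦ h.comp_of_image hinj.injOn, fun h ↦ h.image_of_comp _ _⟩
    rw [h1]
    have h2 := LinearMap.linearIndependent_iff ((LinearMap.ker π).liftQ π le_rfl)
      (Submodule.ker_liftQ_eq_bot _ _ _ le_rfl)
      (v := fun x : T ↦ ((LinearMap.ker π).mkQ (blockVectors b' (false, some x.1))))
    refine h2.symm.trans (iff_of_eq ?_)
    unfold LinearIndepOn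
    congr 1
    ext x
    simp [hπ]
  · rw [hspan, LinearMap.mem_ker, hπ, hx]

theorem exists_embedding_sum_nat {α β τ : Type*} [Finite τ] (j : β ↪ τ) (i : β ↪ α) :
    ∃ g : τ ↪ α ⊕ ℕ, ∀ x, g (j x) = Sum.inl (i x) := by
  classical
  let f : τ → α ⊕ ℕ := fun t ↦
    if h : ∃ x, j x = t then Sum.inl (i h.choose) else Sum.inr (Finite.equivFin τ t : ℕ)
  have hf : Function.Injective f := by
    intro s t hst
    simp only [f] at hst
    split_ifs at hst with hs ht ht
    · rw [← hs.choose_spec, ← ht.choose_spec, i.injective (Sum.inl_injective hst)]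
    · exact (Finite.equivFin τ).injective (Fin.val_injective (Sum.inr_injective hst))
  refine ⟨⟨f, hf⟩, fun x ↦ ?_⟩
  have h : ∃ y, j y = j x := ⟨x, rfl⟩
  change f (j x) = _
  simp only [f, dif_pos h]
  rw [j.injective h.choose_spec]

end Minor

namespace Matroid

variable {α τ γ : Type*}

/-- A minor that keeps all of `X` is, on `X`, a contraction of an independent set. -/
theorem IsMinor.exists_indep_iff_union {M N : Matroid α} (h : N ≤m M) {X : Set α} (hX : X ⊆ N.E) :
    ∃ C, M.Indep C ∧ Disjoint C X ∧ ∀ I ⊆ X, (N.Indep I ↔ M.Indep (I ∪ C)) := by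
  obtain ⟨C, D, rfl⟩ := h
  obtain ⟨B, hB⟩ := M.exists_isBasis' C
  have hCX : Disjoint C X := Set.disjoint_left.2 fun x hxC hxX ↦ (hX hxX).1.2 hxC
  refine ⟨B, hB.indep, hCX.mono_left hB.subset, fun I hI ↦ ?_⟩
  rw [delete_indep_iff, hB.contract_indep_iff, and_iff_left (hCX.mono_right hI), and_iff_left]
  exact Set.disjoint_left.2 fun x hxI hxD ↦ (hX (hI hxI)).2 hxD

theorem isMinor_of_contract_indep_iff {M N : Matroid α} {A : Set α} (hA : M.Indep A)
    (hNE : N.E ⊆ M.E \ A) (h : ∀ I ⊆ N.E, (N.Indep I ↔ M.Indep (I ∪ A))) : N ≤m M := by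
  refine ⟨A, (M.E \ A) \ N.E, ext_indep ?_ fun I hI ↦ ?_⟩
  · rw [delete_ground, contract_ground, sdiff_sdiff_cancel_left hNE]
  · have hIA : Disjoint I A := Set.disjoint_left.2 fun x hx ↦ (hNE (hI hx)).2
    rw [h I hI, delete_indep_iff, hA.contract_indep_iff, and_iff_right hIA, and_iff_left]
    exact disjoint_sdiff_right.mono_left hI

end Matroid

/-! ### Combining the two obstructions -/

section Real

variable {ι γ : Type*} [Fintype ι] {b : Bool → Basis ι ℝ (ι → ℝ)}

theorem planeLiftIndep_cyclicRel_iff (i : Bool)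
    {I : Set ((Bool × Option ι) ⊕ (Bool × Fin 3))}
    (hI : (∀ c, Sum.inl (!i, c) ∈ I) → ∃ c, Sum.inl (i, c) ∈ I) :
    PlaneLiftIndep (BlockIndep b) cyclicRel I ↔
      PlaneLiftIndep (BlockIndep b) (fun _ ↦ cyclicRel i) I := by
  have hcard : ∀ B, BlockIndep b B → B.ncard < Fintype.card (Option ι) := fun B hB ↦ by
    rw [Fintype.card_option]
    exact Nat.lt_succ_of_le hB.ncard_le
  exact ⟨fun h ↦ h.of_rel hcard i (fun _ _ h ↦ h) hI,
    fun h ↦ h.of_rel (rel := fun _ ↦ cyclicRel i) (rel' := cyclicRel) hcard i (fun _ _ h ↦ h) hI⟩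

theorem planeLiftIndep_singleton_inl {C : Type*} {ind : Set (Bool × C) → Prop}
    {rel : Bool → Fin 3 → Fin 3 → Prop} (h0 : ind ∅) (x : Bool × C) :
    PlaneLiftIndep ind rel {Sum.inl x} := by
  have h1 : (Sum.inr ⁻¹' ({Sum.inl x} : Set ((Bool × C) ⊕ (Bool × Fin 3)))) = ∅ := by
    ext; simp
  have h2 : (Sum.inl ⁻¹' ({Sum.inl x} : Set ((Bool × C) ⊕ (Bool × Fin 3)))) = {x} := by
    ext; simp
  unfold PlaneLiftIndep
  rw [h1, h2]
  exact ⟨by simp, ⟨∅, empty_subset _, h0, by simp⟩, by simp⟩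

-- After deletion block `i` is never full, so only the relation of `!i` matters; sets through a
-- contracted element of block `i` feel only the relation of `i`. Either relation alone is real.
open Matroid in
theorem isRepresentable_deleteElem_and_contractElem (hι : 2 ≤ Fintype.card ι)
    {M : Matroid ((Bool × Option ι) ⊕ (Bool × Fin 3))} (hE : M.E = univ)
    (hM : ∀ I, M.Indep I ↔ PlaneLiftIndep (BlockIndep b) cyclicRel I)
    (g : (Bool × Option ι) ⊕ (Bool × Fin 3) ↪ γ) (x : Bool × Option ι) :
    ((M.mapEmbedding g) ＼ {g (Sum.inl x)}).IsRepresentable ℝ ∧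
      ((M.mapEmbedding g) ／ {g (Sum.inl x)}).IsRepresentable ℝ := by
  obtain ⟨i, c⟩ := x
  constructor
  · obtain ⟨v, hv⟩ := exists_real_planeLiftIndep b hι (!i)
    refine ((vectorMatroid_isRepresentable v).mapEmbedding g).delete_of_indep_iff (by simp [hE]) _
      fun I hI ↦ ?_
    rw [mapEmbedding_indep_iff, mapEmbedding_indep_iff, hM, vectorMatroid_indep_iff, hv,
      planeLiftIndep_cyclicRel_iff (!i)]
    intro h
    rw [Bool.not_not] at h
    exact (hI (h c)).elim
  · obtain ⟨v, hv⟩ := exists_real_planeLiftIndep b hι i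
    refine ((vectorMatroid_isRepresentable v).mapEmbedding g).contract_of_indep_iff (by simp [hE]) _
      ?_ fun I hI ↦ ?_
    · rw [← image_singleton]
      refine Indep.mapEmbedding ((hM _).2 (planeLiftIndep_singleton_inl ?_ _)) g
      exact blockIndep_empty b
    · rw [mapEmbedding_indep_iff, mapEmbedding_indep_iff, hM, vectorMatroid_indep_iff, hv,
        planeLiftIndep_cyclicRel_iff i]
      exact fun _ ↦ ⟨c, hI⟩

theorem not_isRepresentable_real_of_planeLiftIndep
    {M : Matroid ((Bool × Option ι) ⊕ (Bool × Fin 3))} (hE : M.E = univ)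
    (hM : ∀ I, M.Indep I ↔ PlaneLiftIndep (BlockIndep b) cyclicRel I) :
    ¬ M.IsRepresentable ℝ := by
  rintro ⟨n, v, hv⟩
  obtain ⟨κ, hκ⟩ := exists_root_of_planeLiftIndep (v := v)
    (fun I ↦ (hv I (hE ▸ subset_univ I)).symm.trans (hM I)) (blockIndep_empty b)
    (fun i ↦ ⟨none, blockIndep_of_ne_none b i⟩) (by simp [cyclicRel]) (by simp [cyclicRel])
  -- A root would give `(2 * κ + 1) ^ 2 = -3`.
  nlinarith [sq_nonneg (2 * κ + 1)]

end Real

theorem theorem1p2 {α : Type*} (N : Matroid α) (hfin : N.Finite)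
    (hN : Matroid.IsRepresentable ℝ N) :
    ∃ (M : Matroid (α ⊕ ℕ)),
      Matroid.IsExcludedMinorFor ℝ M ∧ Matroid.IsRepresentable ℂ M ∧
        (N.mapEmbedding Function.Embedding.inl) ≤m M := by
  classical
  obtain ⟨n, v, hv⟩ := hN
  have : Finite N.E := hfin.ground_finite.to_subtype
  have := Fintype.ofFinite N.E
  -- The three zero vectors are the spare elements that will absorb the rest of the plane; they also
  -- make the index type large enough for the lift.
  let u : N.E ⊕ Fin 3 → Fin n → ℝ := Sum.elim (fun x ↦ v x) 0
  have hcard : 2 ≤ Fintype.card (N.E ⊕ Fin 3) := by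
    rw [Fintype.card_sum, Fintype.card_fin]
    omega
  obtain ⟨b, A, hA, hzero⟩ := exists_bases_blockIndep_iff u
  obtain ⟨v₀, hv₀⟩ := exists_complex_planeLiftIndep_cyclicRel b hcard
  obtain ⟨g, hg⟩ := exists_embedding_sum_nat
    (⟨fun x ↦ Sum.inl (false, some (Sum.inl x)), fun x y h ↦ by simpa using h⟩ :
      N.E ↪ (Bool × Option (N.E ⊕ Fin 3)) ⊕ (Bool × Fin 3)) (Function.Embedding.subtype _)
  replace hg : ∀ x : N.E, g (Sum.inl (false, some (Sum.inl x))) = Sum.inl x.1 := hg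
  set M₀ := Matroid.vectorMatroid ℂ v₀
  have hM₀ : ∀ I, M₀.Indep I ↔ PlaneLiftIndep (BlockIndep b) cyclicRel I := hv₀
  set M' := M₀.mapEmbedding g
  have hM' : ∀ S, M'.Indep (g '' S) ↔ PlaneLiftIndep (BlockIndep b) cyclicRel S := fun S ↦ by
    rw [Matroid.mapEmbedding_indep_iff, preimage_image_eq _ g.injective,
      and_iff_left (image_subset_range _ _), hM₀]
  have hrep : ¬ M'.IsRepresentable ℝ := fun h ↦
    not_isRepresentable_real_of_planeLiftIndep rfl hM₀ h.of_mapEmbedding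
  have hM'fin : M'.Finite := ⟨finite_univ.image g⟩
  obtain ⟨M, hMM', hM⟩ := Matroid.exists_isExcludedMinorFor_isMinor hM'fin hrep
  refine ⟨M, hM, ((Matroid.vectorMatroid_isRepresentable v₀).mapEmbedding g).of_isMinor hMM', ?_⟩
  have hX : ∀ x, g (Sum.inl x) ∈ M.E := fun x ↦ by
    have h := isRepresentable_deleteElem_and_contractElem hcard rfl hM₀ g x
    exact Matroid.mem_ground_of_isMinor_of_not_isRepresentable hMM' hM.2.1
      (mem_image_of_mem g (mem_univ _)) h.1 h.2
  obtain ⟨C, hC, hCX, hCM⟩ := hMM'.exists_indep_iff_union (X := g '' range Sum.inl) (by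
    rintro _ ⟨_, ⟨x, rfl⟩, rfl⟩
    exact hX x)
  -- `M` keeps both blocks, so the contracted set consists of plane elements only.
  obtain ⟨J, rfl⟩ : ∃ J : Set (Bool × Fin 3), C = g '' (Sum.inr '' J) := by
    refine ⟨{y | g (Sum.inr y) ∈ C}, Subset.antisymm (fun t ht ↦ ?_) ?_⟩
    · obtain ⟨x | y, -, rfl⟩ := hC.subset_ground ht
      · exact (Set.disjoint_left.1 hCX ht ⟨_, ⟨x, rfl⟩, rfl⟩).elim
      · exact ⟨_, ⟨y, ht, rfl⟩, rfl⟩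
    · rintro _ ⟨_, ⟨y, hy, rfl⟩, rfl⟩
      exact hy
  rw [hM', PlaneLiftIndep.empty_sum (blockIndep_empty b)] at hC
  -- As many spare elements as there are dimensions of the plane not contracted by `J`.
  obtain ⟨L, -, hL⟩ := exists_subset_card_eq (s := (univ : Set (Fin 3))) (n := 3 - J.ncard)
    (by simp)
  let fA : N.E ⊕ Fin 3 → Bool × Option (N.E ⊕ Fin 3) := fun x ↦ (true, some x)
  let fT : N.E ⊕ Fin 3 → Bool × Option (N.E ⊕ Fin 3) := fun x ↦ (false, some x)
  have hkey : ∀ T : Set N.E,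
      M.Indep (g '' (Sum.inl '' ((fA '' A ∪ fT '' (Sum.inl '' T)) ∪ fT '' (Sum.inr '' L)))) ↔
        N.Indep (Subtype.val '' T) := by
    intro T
    rw [hCM _ (image_mono (image_subset_range _ _)), ← image_union, hM',
      planeLiftIndep_union_iff, hA, hv _ (Subtype.coe_image_subset _ _)]
    · have h1 : LinearIndepOn ℝ u (Sum.inl '' T) ↔ LinearIndepOn ℝ (u ∘ Sum.inl) T :=
        ⟨fun h ↦ h.comp_of_image Sum.inl_injective.injOn, fun h ↦ h.image_of_comp _ _⟩
      have h2 : LinearIndepOn ℝ v (Subtype.val '' T) ↔ LinearIndepOn ℝ (v ∘ Subtype.val) T :=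
        ⟨fun h ↦ h.comp_of_image Subtype.val_injective.injOn, fun h ↦ h.image_of_comp _ _⟩
      exact h1.trans h2.symm
    · rw [Set.disjoint_left]
      rintro _ (⟨x, -, rfl⟩ | ⟨_, ⟨x, -, rfl⟩, rfl⟩) ⟨_, ⟨l, -, rfl⟩, hl⟩
      · simp [fA, fT] at hl
      · simp [fT] at hl
    · rintro _ ⟨_, ⟨_, ⟨l, -, rfl⟩, rfl⟩, rfl⟩
      exact Submodule.span_mono (image_mono subset_union_left) (hzero (Sum.inr l) rfl)
    · rintro i ((⟨_, -, h⟩ | ⟨_, -, h⟩) | ⟨_, -, h⟩) <;> simp [fA, fT] at h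
    · rw [ncard_image_of_injective _ (fun x y h ↦ by simpa [fT] using h),
        ncard_image_of_injective _ Sum.inr_injective, hL]
      omega
    · exact hC.2
  refine Matroid.isMinor_of_contract_indep_iff
    (A := g '' (Sum.inl '' (fA '' A ∪ fT '' (Sum.inr '' L)))) ?_ ?_ fun I hI ↦ ?_
  · have := (hkey ∅).2 (by simp)
    simpa using this
  · rintro _ ⟨x, hx, rfl⟩
    change Sum.inl x ∈ _
    rw [← hg ⟨x, hx⟩]
    refine ⟨hX _, ?_⟩
    rw [g.injective.mem_set_image, Sum.inl_injective.mem_set_image]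
    rintro (⟨_, -, h⟩ | ⟨_, ⟨l, -, rfl⟩, h⟩) <;> simp [fA, fT] at h
  · obtain ⟨I', hI', rfl⟩ := subset_image_iff.1 (show I ⊆ Function.Embedding.inl '' N.E from hI)
    obtain ⟨T, rfl⟩ : ∃ T : Set N.E, Subtype.val '' T = I' :=
      ⟨Subtype.val ⁻¹' I', by rwa [Subtype.image_preimage_coe, inter_eq_right]⟩
    rw [Matroid.mapEmbedding_indep_iff,
      preimage_image_eq _ (Function.Embedding.injective Function.Embedding.inl),
      and_iff_left (image_subset_range _ _), ← hkey T]
    have himage : Function.Embedding.inl '' (Subtype.val '' T) =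
        g '' (Sum.inl '' (fT '' (Sum.inl '' T))) := by
      simp only [image_image, fT, hg]
      rfl
    rw [himage, ← image_union, ← image_union, union_right_comm, union_comm]
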